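/- **Setting.** Let $F_1,\dots,F_N$ be contracting similitudes of $\mathbb R^d$ with distinct fixed points $q_1,\dots,q_N$, and let $F=\bigcup_i F_i(F)$ be their attractor (nonempty, compact), assumed connected. For a finite word $w=w_1\cdots w_n$ over $\mathcal A=\{1,\dots,N\}$ put $F_w=F_{w_1}\circ\cdots\circ F_{w_n}$, with $F_\emptyset=\mathrm{id}$. Let $\mathcal C=\bigcup_{i\ne j}F_i(F)\cap F_j(F)$ be the critical set and $\mathcal P=\{x\in F: F_w(x)\in\mathcal C\text{ for some nonempty word }w\}$ the post critical set. Assume that $\mathcal P$ is finite, that every $p\in\mathcal P$ is of the form $p=F_w(q_k)$ with a finite (possibly empty) word $w$ and $q_k\in\mathcal P$, and that no $q_i$ lies in $\mathcal C$. Fix for every $p\in\mathcal P$ such a representation $p=F_{w(p)}(q_{k(p)})$, in such a way that whenever $w(p)=iw'$, the representation fixed for $F_{w'}(q_{k(p)})$ is $(w',k(p))$. Let $0<\alpha<1$, $G_i=\alpha(F_i-q_i)+q_i$, and $G_w=G_{w_1}\circ\cdots\circ G_{w_n}$. For $p\in\mathcal P$ let $\hat p=G_{w(p)}(q_{k(p)})$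 (so $\hat p=p$ if $p$ is one of the fixed points). For every pair $(c,i)$ with $c\in\mathcal C$ and $c\in F_i(F)$ write $c=F_i(p)$, $p\in\mathcal P$; the corresponding connecting line is the segment $e_{c,i}$ from $c$ to $G_i(\hat p)$, parametrized by $\xi_{c,i}(t)=tG_i(\hat p)+(1-t)c$, $t\in[0,1]$. Let $\Sigma=\bigcup_iG_i(\Sigma)$ be the nonempty compact attractor of the $G_i$, and assume that $\Sigma$ is totally disconnected. The *stretched fractal* is the nonempty compact set $K$ with $$K=\bigcup_{i}G_i(K)\ \cup\ \bigcup_{(c,i)}e_{c,i}.$$ **Harmonic structures.** Let $r_0(p,p')=r_0(p',p)\in(0,\infty]$ for distinct $p,p'\in\mathcal P$, and set $Q_{r_0}(f)=\sum_{\{p,p'\}}\frac1{r_0(p,p')}(f(\hat p)-f(\hat p'))^2$, the sum being over unordered pairs of distinct points of $\mathcal P$. For $\boldsymbol\rho=(\rho_{c,i})$ with $\rho_{c,i}\in(0,\infty)$ set $Q^I_{\boldsymbol\rho}(f)=\sum_{(c,i)}\frac1{\rho_{c,i}}\bigl(f(c)-f(G_i(\hat p))\bigr)^2$. Let $V_0=\{\hat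 p:p\in\mathcal P\}$ and $V_1=\bigcup_iG_i(V_0)\cup\mathcal C$. Then $(r_0,\lambda,\boldsymbol\rho)$ with $0<\lambda<1$ is a *harmonic structure* if any two points of $\mathcal P$ are joined by a chain of pairs with $r_0<\infty$, and for all $g:V_0\to\mathbb R$ $$Q_{r_0}(g)=\inf\Bigl\{\tfrac1\lambda\sum_iQ_{r_0}(f\circ G_i)+Q^I_{\boldsymbol\rho}(f)\ :\ f:V_1\to\mathbb R,\ f|_{V_0}=g\Bigr\}.$$ A sequence $\mathcal R=(\lambda_n,\boldsymbol\rho^n)_{n\ge1}$ of harmonic structures with the same $r_0$ is *regular* if $\lambda_n\le\lambda^*$ for all $n$ with some $\lambda^*<1$, and $\sup_{n,(c,i)}\rho^n_{c,i}<\infty$. **The form.** Put $\delta_n=\lambda_1\cdots\lambda_n$, $\delta_0=1$, and $$\mathcal E_{\mathcal R,n}(u)=\frac1{\delta_n}\sum_{w\in\mathcal A^n}Q_{r_0}(u\circ G_w)+\sum_{k=1}^n\frac1{\delta_{k-1}}\sum_{w\in\mathcal A^{k-1}}\sum_{(c,i)}\frac1{\rho^k_{c,i}}\int_0^1\Bigl(\frac{d}{dt}\,u(G_w(\xi_{c,i}(t)))\Bigr)^2dt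 .$$ Let $\mathcal F_{\mathcal R}$ be the set of all continuous $u:K\to\mathbb R$ such that $u\circ G_w\circ\xi_{c,i}\in H^1[0,1]$ for all finite words $w$ and all $(c,i)$, and such that $\mathcal E_{\mathcal R}(u):=\lim_{n\to\infty}\mathcal E_{\mathcal R,n}(u)$ exists and is finite. **Theorem.** Let $\mathcal R$ be a regular sequence of harmonic structures on $K$. Then $(\mathcal E_{\mathcal R},\mathcal F_{\mathcal R})$ is a resistance form on $K$, that is: 1. $\mathcal F_{\mathcal R}$ is a linear space of real functions on $K$ containing the constants, and $\mathcal E_{\mathcal R}$ is a nonnegative symmetric quadratic form on it with $\mathcal E_{\mathcal R}(u)=0$ if and only if $u$ is constant; 2. $\mathcal F_{\mathcal R}$ modulo constants is a Hilbert space with respect to $\mathcal E_{\mathcal R}$; 3. $\mathcal F_{\mathcal R}$ separates the points of $K$; 4. $R_{\mathcal R}(x,y)=\sup\bigl\{\frac{|u(x)-u(y)|^2}{\mathcal E_{\mathcal R}(u)}:u\in\mathcal F_{\mathcal R},\ \mathcal E_{\mathcal R}(u)>0\bigr\}$ is finite for all $x,y\in K$ (with value $0$ for an empty supremum); 5. if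 $u\in\mathcal F_{\mathcal R}$ and $\bar u=\max(0,\min(1,u))$, then $\bar u\in\mathcal F_{\mathcal R}$ and $\mathcal E_{\mathcal R}(\bar u)\le\mathcal E_{\mathcal R}(u)$. Moreover, $R_{\mathcal R}$ is a metric on $K$, and it induces the Euclidean topology of $K$. -/

import Mathlib

open Filter Topology

/-- `F_w = F_{w_1} ∘ ⋯ ∘ F_{w_n}` for a finite word `w`; the identity for the empty word. -/
def wordMap {X : Type*} {N : ℕ} (F : Fin N → X → X) : List (Fin N) → X → X
  | [] => id
  | i :: w => F i ∘ wordMap F w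

/-! ### Connected self-similar sets, critical and post critical points -/

/-- A connected self-similar set `carrier ⊆ ℝ^d`, the attractor of the contracting similitudes
`map 0, …, map (N-1)`, whose fixed points `fixedPt i` are distinct. -/
structure SelfSimilarSet (d N : ℕ) where
  map : Fin N → EuclideanSpace ℝ (Fin d) → EuclideanSpace ℝ (Fin d)
  ratio : Fin N → ℝ
  fixedPt : Fin N → EuclideanSpace ℝ (Fin d)
  carrier : Set (EuclideanSpace ℝ (Fin d))
  ratio_pos : ∀ i, 0 < ratio i
  ratio_lt_one : ∀ i, ratio i < 1
  dist_map : ∀ i x y, dist (map i x) (map i y) = ratio i * dist x y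
  map_fixedPt : ∀ i, map i (fixedPt i) = fixedPt i
  fixedPt_injective : Function.Injective fixedPt
  isCompact_carrier : IsCompact carrier
  isConnected_carrier : IsConnected carrier
  carrier_eq : carrier = ⋃ i, map i '' carrier

namespace SelfSimilarSet

variable {d N : ℕ}

/-- The critical set `C`: the points where two different 1-cells meet. -/
def critical (S : SelfSimilarSet d N) : Set (EuclideanSpace ℝ (Fin d)) :=
  {x | ∃ i j, i ≠ j ∧ x ∈ S.map i '' S.carrier ∧ x ∈ S.map j '' S.carrier}

/-- The post critical set `P`: the points of the self-similar set that are mapped into the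
critical set by some nonempty word. -/
def postCritical (S : SelfSimilarSet d N) : Set (EuclideanSpace ℝ (Fin d)) :=
  {x | x ∈ S.carrier ∧ ∃ w : List (Fin N), w ≠ [] ∧ wordMap S.map w x ∈ S.critical}

end SelfSimilarSet

/-- A connected post critically finite self-similar set that can be stretched: every post critical
point is the image, under a finite word, of a fixed point which is itself post critical, and no
fixed point of a similitude is critical. -/
structure StretchableSet (d N : ℕ) extends SelfSimilarSet d N where
  finite_postCritical : toSelfSimilarSet.postCritical.Finite
  postCritical_eq : ∀ p ∈ toSelfSimilarSet.postCritical, ∃ (w : List (Fin N)) (k : Fin N),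
    fixedPt k ∈ toSelfSimilarSet.postCritical ∧ p = wordMap map w (fixedPt k)
  fixedPt_notMem_critical : ∀ k, fixedPt k ∉ toSelfSimilarSet.critical

namespace StretchableSet

variable {d N : ℕ}

noncomputable instance (S : StretchableSet d N) : Fintype S.postCritical :=
  S.finite_postCritical.fintype

/-- A choice, for every post critical point `p`, of a word `w = word p` and a post critical fixed
point `q_k`, `k = letter p`, with `p = F_w(q_k)`. The choice is required to be compatible with
removing the first letter of a word: if `w = i w'`, then the representation chosen for the post
critical point `F_{w'}(q_k)` is `(w', k)`. -/
structure Addressing (S : StretchableSet d N) where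
  word : S.postCritical → List (Fin N)
  letter : S.postCritical → Fin N
  fixedPt_mem : ∀ p, S.fixedPt (letter p) ∈ S.postCritical
  wordMap_eq : ∀ p, wordMap S.map (word p) (S.fixedPt (letter p)) = p
  tail : ∀ (p p' : S.postCritical) (i : Fin N) (w : List (Fin N)), word p = i :: w →
    (p' : EuclideanSpace ℝ (Fin d)) = wordMap S.map w (S.fixedPt (letter p)) →
      word p' = w ∧ letter p' = letter p

/-- Index set of the connecting lines. A pair `(c, i)` of a critical point `c` and a letter `i` with
`c ∈ F_i(F)` is recorded as `(i, p)`, where `p` is the (post critical) point with `F_i(p) = c`.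
So exactly `#{i | c ∈ F_i(F)}` indices, the multiplicity of `c`, belong to each critical `c`. -/
abbrev LineIndex (S : StretchableSet d N) : Type :=
  {x : Fin N × S.postCritical // S.map x.1 x.2 ∈ S.critical}

noncomputable instance (S : StretchableSet d N) : Fintype S.LineIndex :=
  Fintype.ofFinite _

/-- The critical point at which a connecting line starts. -/
def lineStart (S : StretchableSet d N) (l : S.LineIndex) : EuclideanSpace ℝ (Fin d) :=
  S.map l.1.1 l.1.2

/-! ### Stretching -/

/-- The stretched similitudes `G_i = α (F_i - q_i) + q_i`. -/
noncomputable def stretch (S : StretchableSet d N) (α : ℝ) (i : Fin N)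
    (x : EuclideanSpace ℝ (Fin d)) : EuclideanSpace ℝ (Fin d) :=
  α • (S.map i x - S.fixedPt i) + S.fixedPt i

/-- The attractor of the stretched similitudes, the fractal part of the stretched fractal. -/
def IsFractalPart (S : StretchableSet d N) (α : ℝ) (A : Set (EuclideanSpace ℝ (Fin d))) : Prop :=
  IsCompact A ∧ A.Nonempty ∧ A = ⋃ i, S.stretch α i '' A

namespace Addressing

variable {S : StretchableSet d N}

/-- The vertex `G_w(q_k)` representing the post critical point `p = F_w(q_k)` after stretching.
It is `p` itself if `p` is a fixed point. These are the vertices in `V_0`. -/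
noncomputable def vertex (T : S.Addressing) (α : ℝ) (p : S.postCritical) :
    EuclideanSpace ℝ (Fin d) :=
  wordMap (S.stretch α) (T.word p) (S.fixedPt (T.letter p))

/-- The point that is pulled away from the critical point `c = F_i(p)` by the stretching. With
`p = F_w(q_k)` it is `G_{iw}(q_k)`. -/
noncomputable def lineEnd (T : S.Addressing) (α : ℝ) (l : S.LineIndex) :
    EuclideanSpace ℝ (Fin d) :=
  wordMap (S.stretch α) (l.1.1 :: T.word l.1.2) (S.fixedPt (T.letter l.1.2))

/-- The affine parametrization of a connecting line. -/
noncomputable def linePath (T : S.Addressing) (α : ℝ) (l : S.LineIndex) (t : ℝ) :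
    EuclideanSpace ℝ (Fin d) :=
  t • T.lineEnd α l + (1 - t) • S.lineStart l

/-- The stretched fractal: the compact set `K` which is the union of its images under the `G_i`
and of the connecting lines. -/
def IsStretchedFractal (T : S.Addressing) (α : ℝ) (K : Set (EuclideanSpace ℝ (Fin d))) : Prop :=
  IsCompact K ∧ K.Nonempty ∧
    K = (⋃ i, S.stretch α i '' K) ∪ ⋃ l : S.LineIndex, T.linePath α l '' Set.Icc 0 1

/-! ### Graph energies and harmonic structures

Functions on vertex sets are given as restrictions of functions on the ambient space; the energies
only use the values on the vertices. The edges of `E_0` are the unordered pairs of distinct post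
critical points, and the factor `1/2` passes from ordered to unordered pairs. Resistances on `E_0`
may be infinite. -/

/-- `Q^Σ_{r_0}(f)`, the energy of the network `(V_0, E_0, r_0)`. -/
noncomputable def fractalEnergy (T : S.Addressing) (α : ℝ)
    (r₀ : S.postCritical → S.postCritical → ENNReal) (f : EuclideanSpace ℝ (Fin d) → ℝ) : ℝ :=
  (1 / 2) * ∑ p, ∑ p', ((r₀ p p')⁻¹).toReal * (f (T.vertex α p) - f (T.vertex α p')) ^ 2

/-- `Q^I_ρ(f)`, the energy of the connecting edges in the first graph. -/
noncomputable def connectingEnergy (T : S.Addressing) (α : ℝ) (ρ : S.LineIndex → ℝ)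
    (f : EuclideanSpace ℝ (Fin d) → ℝ) : ℝ :=
  ∑ l, (ρ l)⁻¹ * (f (S.lineStart l) - f (T.lineEnd α l)) ^ 2

/-- `E_1(f)`, the energy of the network `(V_1, E_1, r_1)`. -/
noncomputable def firstEnergy (T : S.Addressing) (α : ℝ)
    (r₀ : S.postCritical → S.postCritical → ENNReal) (lam : ℝ) (ρ : S.LineIndex → ℝ)
    (f : EuclideanSpace ℝ (Fin d) → ℝ) : ℝ :=
  (∑ i, lam⁻¹ * T.fractalEnergy α r₀ (f ∘ S.stretch α i)) + T.connectingEnergy α ρ f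

/-- `(r₀, lam, ρ)` is a harmonic structure: `(V_0, E_0, r_0)` is a connected network, and the trace
of `E_1` on `V_0` is `E_0`. -/
structure IsHarmonicStructure (T : S.Addressing) (α : ℝ)
    (r₀ : S.postCritical → S.postCritical → ENNReal) (lam : ℝ) (ρ : S.LineIndex → ℝ) : Prop where
  symm : ∀ p p', r₀ p p' = r₀ p' p
  resistance_pos : ∀ p p', p ≠ p' → 0 < r₀ p p'
  lam_pos : 0 < lam
  lam_lt_one : lam < 1
  rho_pos : ∀ l, 0 < ρ l
  connected : ∀ p p', Relation.ReflTransGen (fun a b => a ≠ b ∧ r₀ a b < ⊤) p p'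
  trace : ∀ g : EuclideanSpace ℝ (Fin d) → ℝ,
    IsGLB {s : ℝ | ∃ f : EuclideanSpace ℝ (Fin d) → ℝ,
      (∀ p, f (T.vertex α p) = g (T.vertex α p)) ∧ s = T.firstEnergy α r₀ lam ρ f}
      (T.fractalEnergy α r₀ g)

/-- A regular sequence of harmonic structures with common `r₀`. The terms `lam k`, `ρ k` with
`k = 0, 1, 2, …` are the `λ_{k+1}`, `ρ^{k+1}` of the usual numbering from 1. -/
structure IsRegularSequence (T : S.Addressing) (α : ℝ)
    (r₀ : S.postCritical → S.postCritical → ENNReal) (lam : ℕ → ℝ) (ρ : ℕ → S.LineIndex → ℝ) :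
    Prop where
  harmonic : ∀ k, T.IsHarmonicStructure α r₀ (lam k) (ρ k)
  lam_le : ∃ lamStar < 1, ∀ k, lam k ≤ lamStar
  rho_le : ∃ rhoStar, ∀ k l, ρ k l ≤ rhoStar

end Addressing

end StretchableSet

/-! ### The Sobolev space `H^1[0,1]` -/

/-- `f ∈ H^1[0,1]`: absolutely continuous with square integrable derivative. -/
def MemH1 (f : ℝ → ℝ) : Prop :=
  AbsolutelyContinuousOnInterval f 0 1 ∧
    IntervalIntegrable (fun t => deriv f t ^ 2) MeasureTheory.volume 0 1

/-- The Dirichlet energy on `[0,1]`. -/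
noncomputable def dirichletEnergy (f : ℝ → ℝ) : ℝ :=
  ∫ t in (0 : ℝ)..1, deriv f t ^ 2

/-- Extension by zero of a function on `K` to the ambient space. It only serves to write down
compositions; everything below evaluates it at points of `K` alone. -/
noncomputable def extendZero {X : Type*} {K : Set X} (u : K → ℝ) : X → ℝ :=
  Function.extend Subtype.val u 0

namespace StretchableSet.Addressing

variable {d N : ℕ} {S : StretchableSet d N}

/-! ### The limit form -/

/-- `D_ρ(f)`, the sum of the Dirichlet energies on the connecting lines, scaled by `1 / ρ`. -/
noncomputable def lineEnergy (T : S.Addressing) (α : ℝ) (ρ : S.LineIndex → ℝ)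
    (f : EuclideanSpace ℝ (Fin d) → ℝ) : ℝ :=
  ∑ l, (ρ l)⁻¹ * dirichletEnergy (f ∘ T.linePath α l)

/-- `E_{R,n}`: the energy of the fractal edges of level `n`, scaled by
`1 / (λ_1 ⋯ λ_n)`, plus the energies of the connecting lines of level `k + 1 ≤ n`, scaled by
`1 / (λ_1 ⋯ λ_k)`. -/
noncomputable def levelEnergy (T : S.Addressing) (α : ℝ)
    (r₀ : S.postCritical → S.postCritical → ENNReal) (lam : ℕ → ℝ) (ρ : ℕ → S.LineIndex → ℝ)
    (n : ℕ) (f : EuclideanSpace ℝ (Fin d) → ℝ) : ℝ :=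
  (∏ j ∈ Finset.range n, lam j)⁻¹ *
      ∑ w : Fin n → Fin N, T.fractalEnergy α r₀ (f ∘ wordMap (S.stretch α) (List.ofFn w)) +
    ∑ k ∈ Finset.range n, (∏ j ∈ Finset.range k, lam j)⁻¹ *
      ∑ w : Fin k → Fin N, T.lineEnergy α (ρ k) (f ∘ wordMap (S.stretch α) (List.ofFn w))

/-- `F_R`: the continuous functions on `K` that are `H^1` along all connecting lines `G_w(e_l)` of
all levels and for which the energies `E_{R,n}` have a finite limit. -/
def limitDomain (T : S.Addressing) (α : ℝ)
    (r₀ : S.postCritical → S.postCritical → ENNReal) (lam : ℕ → ℝ) (ρ : ℕ → S.LineIndex → ℝ)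
    (K : Set (EuclideanSpace ℝ (Fin d))) : Set (K → ℝ) :=
  {u | Continuous u ∧
    (∀ (w : List (Fin N)) (l : S.LineIndex),
      MemH1 (extendZero u ∘ wordMap (S.stretch α) w ∘ T.linePath α l)) ∧
    ∃ e : ℝ, Tendsto (fun n => T.levelEnergy α r₀ lam ρ n (extendZero u)) atTop (𝓝 e)}

/-- `E_R(u) = lim E_{R,n}(u)`, a genuine limit for `u` in `limitDomain`. -/
noncomputable def limitEnergy (T : S.Addressing) (α : ℝ)
    (r₀ : S.postCritical → S.postCritical → ENNReal) (lam : ℕ → ℝ) (ρ : ℕ → S.LineIndex → ℝ)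
    (K : Set (EuclideanSpace ℝ (Fin d))) (u : K → ℝ) : ℝ :=
  limUnder atTop (fun n => T.levelEnergy α r₀ lam ρ n (extendZero u))

end StretchableSet.Addressing

/-! ### Resistance forms -/

/-- The set whose supremum is the resistance between `p` and `q`. -/
def resistanceSet {X : Type*} (dom : Set (X → ℝ)) (E : (X → ℝ) → ℝ) (p q : X) : Set ℝ :=
  {s | ∃ u ∈ dom, 0 < E u ∧ s = |u p - u q| ^ 2 / E u}

/-- The resistance metric. -/
noncomputable def resistance {X : Type*} (dom : Set (X → ℝ)) (E : (X → ℝ) → ℝ) (p q : X) : ℝ :=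
  sSup (resistanceSet dom E p q)

/-- `(E, dom)` is a resistance form on `X`. -/
structure IsResistanceForm {X : Type*} (dom : Set (X → ℝ)) (E : (X → ℝ) → ℝ) : Prop where
  /-- The domain is a linear space, and `E` is a symmetric quadratic form on it, -/
  quadratic : ∃ (V : Submodule ℝ (X → ℝ)) (B : LinearMap.BilinForm ℝ V),
    (V : Set (X → ℝ)) = dom ∧ (∀ u v, B u v = B v u) ∧ ∀ u : V, E u = B u u
  /-- constants belong to the domain, -/
  const_mem : ∀ a : ℝ, (fun _ => a) ∈ dom
  /-- `E` is nonnegative, and it vanishes exactly at the constants. -/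
  nonneg : ∀ u ∈ dom, 0 ≤ E u
  eq_zero_iff : ∀ u ∈ dom, E u = 0 ↔ ∃ a : ℝ, u = fun _ => a
  /-- The domain modulo constants is complete for the norm `E(u)^{1/2}`. -/
  complete : ∀ u : ℕ → X → ℝ, (∀ n, u n ∈ dom) →
    (∀ ε > 0, ∃ n₀, ∀ m ≥ n₀, ∀ n ≥ n₀, E (u m - u n) < ε) →
      ∃ v ∈ dom, Tendsto (fun n => E (u n - v)) atTop (𝓝 0)
  /-- The domain separates points. -/
  separates : ∀ x y, x ≠ y → ∃ u ∈ dom, u x ≠ u y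
  /-- Resistances are finite. -/
  finite_resistance : ∀ p q, BddAbove (resistanceSet dom E p q)
  /-- The unit contraction operates. -/
  markov : ∀ u ∈ dom, (fun x => max 0 (min 1 (u x))) ∈ dom ∧
    E (fun x => max 0 (min 1 (u x))) ≤ E u

/-! ### One-dimensional Sobolev functions -/

section SobolevInterval

open MeasureTheory Set

/-! Monotonicity: on a connecting line, Cauchy–Schwarz bounds the squared difference of the end
values by the Dirichlet energy. Inserting a function as competitor in the trace condition of its own
cell therefore shows that the level energies increase with the level (`levelEnergy_mono`). Hence the
domain consists of the continuous linewise `H^1` functions with bounded level energies, and the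
limit is again a quadratic form.

Oscillation: since the self-similar set is connected, its 1-cells are chained together by critical
points, that is, by pairs of connecting lines with a common start. So the variation of a function
over the base points of the 1-cells and over the lines is at most a constant times the square root
of the energy. In a cell of level `n` this gains the factor `√δ_n`; as `λ_n ≤ λ* < 1`, summing over
nested cells gives a geometric series, and continuity reaches the remaining points
(`exists_abs_sub_le`). The result `(u x - u y)^2 ≤ M δ_n E(u)` on cells of level `n` yields that
energy zero means constant, that resistances are finite, that energy-Cauchy sequences converge
uniformly after normalization, and that cells are small in the resistance metric. With the Hölder
bound on lines the resistance is continuous for the Euclidean topology, and compactness makes the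
topologies equal.

Contractions: if the squared increments of `f` and `g` add up to at most those of `u`, so do the
energies (`mem_of_sq_add_sq_le`). With `g = 0` this gives the Markov property; with positive and
negative parts it gives the triangle inequality.

Separation: near the totally disconnected fractal part a Lipschitz function can be chosen locally
constant, so that it is constant on all sufficiently small cells and its level energies are
eventually constant. -/

theorem AbsolutelyContinuousOnInterval.of_dist_le {f g : ℝ → ℝ} {a b : ℝ}
    (hg : AbsolutelyContinuousOnInterval g a b)
    (h : ∀ x ∈ uIcc a b, ∀ y ∈ uIcc a b, dist (f x) (f y) ≤ dist (g x) (g y)) :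
    AbsolutelyContinuousOnInterval f a b := by
  rw [absolutelyContinuousOnInterval_iff] at hg ⊢
  intro ε hε
  obtain ⟨δ, hδ, H⟩ := hg ε hε
  exact ⟨δ, hδ, fun E hE hlt => (Finset.sum_le_sum fun i hi =>
    h _ (hE.1 i hi).1 _ (hE.1 i hi).2).trans_lt (H E hE hlt)⟩

/-- The endpoints are null; there the two-sided `deriv` would also depend on values outside the
interval. -/
theorem ae_restrict_unitInterval {p : ℝ → Prop} (h : ∀ᵐ t : ℝ, t ∈ Ioo (0 : ℝ) 1 → p t) :
    ∀ᵐ t ∂(volume.restrict (Ioc (0 : ℝ) 1)), p t := by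
  rw [← restrict_Ioo_eq_restrict_Ioc, ae_restrict_iff' measurableSet_Ioo]
  exact h

theorem memH1_iff {f : ℝ → ℝ} : MemH1 f ↔ AbsolutelyContinuousOnInterval f 0 1 ∧
    MemLp (deriv f) 2 (volume.restrict (Ioc (0 : ℝ) 1)) := by
  rw [MemH1, memLp_two_iff_integrable_sq (measurable_deriv f).aestronglyMeasurable,
    intervalIntegrable_iff_integrableOn_Ioc_of_le zero_le_one]
  rfl

theorem MemH1.memLp_deriv {f : ℝ → ℝ} (hf : MemH1 f) :
    MemLp (deriv f) 2 (volume.restrict (Ioc (0 : ℝ) 1)) :=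
  (memH1_iff.1 hf).2

theorem MemH1.ae_differentiableAt {f : ℝ → ℝ} (hf : MemH1 f) :
    ∀ᵐ t ∂(volume.restrict (Ioc (0 : ℝ) 1)), DifferentiableAt ℝ f t := by
  refine ae_restrict_unitInterval ?_
  filter_upwards [hf.1.ae_differentiableAt] with t ht h
  exact ht (by rw [uIcc_of_le zero_le_one]; exact Ioo_subset_Icc_self h)

theorem dirichletEnergy_eq (f : ℝ → ℝ) :
    dirichletEnergy f = ∫ t in Ioc (0 : ℝ) 1, deriv f t ^ 2 :=
  intervalIntegral.integral_of_le zero_le_one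

theorem dirichletEnergy_nonneg (f : ℝ → ℝ) : 0 ≤ dirichletEnergy f := by
  rw [dirichletEnergy_eq]
  exact integral_nonneg fun t => sq_nonneg _

/-- Cauchy–Schwarz on a subinterval of the unit interval. -/
theorem sq_intervalIntegral_le {h : ℝ → ℝ}
    (hh : MemLp h 2 (volume.restrict (Ioc (0 : ℝ) 1))) {s t : ℝ} (hs : 0 ≤ s) (hst : s ≤ t)
    (ht : t ≤ 1) :
    (∫ x in s..t, h x) ^ 2 ≤ (t - s) * ∫ x in Ioc (0 : ℝ) 1, h x ^ 2 := by
  have hsub : Ioc s t ⊆ Ioc 0 1 := Ioc_subset_Ioc hs ht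
  have hsq : IntegrableOn (fun x => h x ^ 2) (Ioc 0 1) := hh.integrable_sq
  have hi : IntegrableOn h (Ioc 0 1) := hh.integrable (by norm_num)
  rw [intervalIntegral.integral_of_le hst]
  set I := ∫ x in Ioc s t, h x with hI
  have hmono : ∫ x in Ioc s t, h x ^ 2 ≤ ∫ x in Ioc (0 : ℝ) 1, h x ^ 2 :=
    setIntegral_mono_set hsq (Eventually.of_forall fun x => sq_nonneg _)
      hsub.eventuallyLE
  rcases hst.eq_or_lt with rfl | hlt
  · simp [hI]
  have hpos : 0 < t - s := sub_pos.2 hlt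
  -- `c` is the mean of `h`; the inequality is the nonnegativity of the variance.
  set c := I / (t - s) with hc
  have hIc : I = c * (t - s) := by rw [hc]; field_simp
  have h1 : 0 ≤ ∫ x in Ioc s t, (h x - c) ^ 2 := integral_nonneg fun x => sq_nonneg _
  have h2 : ∫ x in Ioc s t, (h x - c) ^ 2 =
      (∫ x in Ioc s t, h x ^ 2) - 2 * c * I + c ^ 2 * (t - s) := by
    have e : (fun x => (h x - c) ^ 2) = fun x => (h x ^ 2 - 2 * c * h x) + c ^ 2 := by
      funext x; ring
    rw [e, integral_add, integral_sub, integral_const_mul]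
    · simp [hlt.le]
      ring
    · exact hsq.mono_set hsub
    · exact (hi.mono_set hsub).const_mul _
    · exact (hsq.mono_set hsub).sub ((hi.mono_set hsub).const_mul _)
    · exact integrable_const _
  have h3 : I ^ 2 ≤ (t - s) * ∫ x in Ioc s t, h x ^ 2 := by
    have : c ^ 2 * (t - s) ≤ ∫ x in Ioc s t, h x ^ 2 := by
      rw [h2, hIc] at h1; nlinarith
    calc I ^ 2 = (t - s) * (c ^ 2 * (t - s)) := by rw [hIc]; ring
      _ ≤ _ := by gcongr
  exact h3.trans (by gcongr)

theorem MemH1.intervalIntegral_deriv {f : ℝ → ℝ} (hf : MemH1 f) {s t : ℝ} (hs : s ∈ Icc (0 : ℝ) 1)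
    (ht : t ∈ Icc (0 : ℝ) 1) : ∫ x in s..t, deriv f x = f t - f s := by
  refine (hf.1.mono ?_).integral_deriv_eq_sub
  rw [uIcc_of_le (zero_le_one' ℝ)]
  exact uIcc_subset_Icc hs ht

/-- Functions in `H^1` are Hölder continuous with exponent `1/2`. -/
theorem MemH1.sq_sub_le {f : ℝ → ℝ} (hf : MemH1 f) {s t : ℝ} (hs : s ∈ Icc (0 : ℝ) 1)
    (ht : t ∈ Icc (0 : ℝ) 1) : (f t - f s) ^ 2 ≤ |t - s| * dirichletEnergy f := by
  wlog hst : s ≤ t generalizing s t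
  · have := this ht hs (le_of_not_ge hst)
    rwa [abs_sub_comm, ← neg_sub, neg_sq] at this
  rw [← hf.intervalIntegral_deriv hs ht, abs_of_nonneg (sub_nonneg.2 hst), dirichletEnergy_eq]
  exact sq_intervalIntegral_le hf.memLp_deriv hs.1 hst ht.2

/-- Divide the inequality with `y = t` by `(x - t)^2` and let `x → t`. -/
theorem sq_deriv_add_sq_deriv_le {f g u : ℝ → ℝ} {s : Set ℝ} {t : ℝ} (hs : s ∈ 𝓝 t)
    (hf : DifferentiableAt ℝ f t) (hg : DifferentiableAt ℝ g t) (hu : DifferentiableAt ℝ u t)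
    (h : ∀ x ∈ s, ∀ y ∈ s, (f x - f y) ^ 2 + (g x - g y) ^ 2 ≤ (u x - u y) ^ 2) :
    deriv f t ^ 2 + deriv g t ^ 2 ≤ deriv u t ^ 2 := by
  have hf' := hasDerivAt_iff_tendsto_slope.1 hf.hasDerivAt
  have hg' := hasDerivAt_iff_tendsto_slope.1 hg.hasDerivAt
  have hu' := hasDerivAt_iff_tendsto_slope.1 hu.hasDerivAt
  refine le_of_tendsto_of_tendsto ((hf'.pow 2).add (hg'.pow 2)) (hu'.pow 2) ?_
  filter_upwards [mem_nhdsWithin_of_mem_nhds hs, self_mem_nhdsWithin] with x hx hne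
  have := h x hx t (mem_of_mem_nhds hs)
  simp only [slope_def_field, div_pow, ← add_div]
  gcongr

/-- A pair of functions whose increments are dominated by those of an `H^1` function. -/
theorem MemH1.of_sq_add_sq_le {f g u : ℝ → ℝ} (hu : MemH1 u)
    (h : ∀ x ∈ Icc (0 : ℝ) 1, ∀ y ∈ Icc (0 : ℝ) 1,
      (f x - f y) ^ 2 + (g x - g y) ^ 2 ≤ (u x - u y) ^ 2) :
    MemH1 f ∧ MemH1 g ∧ dirichletEnergy f + dirichletEnergy g ≤ dirichletEnergy u := by
  have hf : AbsolutelyContinuousOnInterval f 0 1 := hu.1.of_dist_le fun x hx y hy => by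
    rw [uIcc_of_le (zero_le_one' ℝ)] at hx hy
    rw [Real.dist_eq, Real.dist_eq, ← sq_le_sq]
    nlinarith [h x hx y hy, sq_nonneg (g x - g y)]
  have hg : AbsolutelyContinuousOnInterval g 0 1 := hu.1.of_dist_le fun x hx y hy => by
    rw [uIcc_of_le (zero_le_one' ℝ)] at hx hy
    rw [Real.dist_eq, Real.dist_eq, ← sq_le_sq]
    nlinarith [h x hx y hy, sq_nonneg (f x - f y)]
  have hd : ∀ᵐ t ∂(volume.restrict (Ioc (0 : ℝ) 1)),
      deriv f t ^ 2 + deriv g t ^ 2 ≤ deriv u t ^ 2 := by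
    refine ae_restrict_unitInterval ?_
    filter_upwards [hf.ae_differentiableAt, hg.ae_differentiableAt, hu.1.ae_differentiableAt]
      with t h1 h2 h3 ht
    have ht' : t ∈ uIcc (0 : ℝ) 1 := by
      rw [uIcc_of_le zero_le_one]; exact Ioo_subset_Icc_self ht
    exact sq_deriv_add_sq_deriv_le (Icc_mem_nhds ht.1 ht.2) (h1 ht') (h2 ht') (h3 ht') h
  have hf2 : MemLp (deriv f) 2 (volume.restrict (Ioc (0 : ℝ) 1)) := by
    refine hu.memLp_deriv.mono (measurable_deriv f).aestronglyMeasurable ?_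
    filter_upwards [hd] with t ht
    rw [Real.norm_eq_abs, Real.norm_eq_abs, ← sq_le_sq]
    nlinarith [sq_nonneg (deriv g t)]
  have hg2 : MemLp (deriv g) 2 (volume.restrict (Ioc (0 : ℝ) 1)) := by
    refine hu.memLp_deriv.mono (measurable_deriv g).aestronglyMeasurable ?_
    filter_upwards [hd] with t ht
    rw [Real.norm_eq_abs, Real.norm_eq_abs, ← sq_le_sq]
    nlinarith [sq_nonneg (deriv f t)]
  refine ⟨memH1_iff.2 ⟨hf, hf2⟩, memH1_iff.2 ⟨hg, hg2⟩, ?_⟩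
  rw [dirichletEnergy_eq, dirichletEnergy_eq, dirichletEnergy_eq,
    ← integral_add hf2.integrable_sq hg2.integrable_sq]
  exact integral_mono_ae (hf2.integrable_sq.add hg2.integrable_sq)
    hu.memLp_deriv.integrable_sq hd

theorem memH1_of_lipschitzWith {f : ℝ → ℝ} {C : NNReal} (hf : LipschitzWith C f) : MemH1 f := by
  refine memH1_iff.2 ⟨hf.lipschitzOnWith.absolutelyContinuousOnInterval, ?_⟩
  refine MemLp.of_bound (measurable_deriv f).aestronglyMeasurable C (Eventually.of_forall fun t => ?_)
  exact norm_deriv_le_of_lipschitz hf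

/-- On the unit interval `g` has the increments of `f`, so the pair `(g, 0)` is dominated by `f`. -/
theorem MemH1.congr {f g : ℝ → ℝ} (hf : MemH1 f) (h : EqOn f g (Icc 0 1)) : MemH1 g :=
  (hf.of_sq_add_sq_le (f := g) (g := 0) fun x hx y hy => by simp [h hx, h hy]).1

theorem deriv_ae_eq_of_eqOn {f g : ℝ → ℝ} (h : EqOn f g (Icc 0 1)) :
    deriv f =ᵐ[volume.restrict (Ioc (0 : ℝ) 1)] deriv g := by
  refine ae_restrict_unitInterval (Eventually.of_forall fun t ht => ?_)
  exact (h.eventuallyEq_of_mem (Icc_mem_nhds ht.1 ht.2)).deriv_eq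

theorem dirichletEnergy_congr {f g : ℝ → ℝ} (h : EqOn f g (Icc 0 1)) :
    dirichletEnergy f = dirichletEnergy g := by
  rw [dirichletEnergy_eq, dirichletEnergy_eq]
  refine integral_congr_ae ?_
  filter_upwards [deriv_ae_eq_of_eqOn h] with t ht
  rw [ht]

theorem dirichletEnergy_const (c : ℝ) : dirichletEnergy (fun _ => c) = 0 := by
  simp [dirichletEnergy]

theorem MemH1.deriv_add {f g : ℝ → ℝ} (hf : MemH1 f) (hg : MemH1 g) :
    deriv (f + g) =ᵐ[volume.restrict (Ioc (0 : ℝ) 1)] deriv f + deriv g := by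
  filter_upwards [hf.ae_differentiableAt, hg.ae_differentiableAt] with t h1 h2
  exact _root_.deriv_add h1 h2

theorem MemH1.deriv_smul {f : ℝ → ℝ} (c : ℝ) (hf : MemH1 f) :
    deriv (c • f) =ᵐ[volume.restrict (Ioc (0 : ℝ) 1)] c • deriv f := by
  filter_upwards [hf.ae_differentiableAt] with t h1
  exact deriv_const_smul c h1

/-- The space `H^1[0,1]`. -/
def sobolevH1 : Submodule ℝ (ℝ → ℝ) where
  carrier := {f | MemH1 f}
  add_mem' hf hg := memH1_iff.2 ⟨hf.1.add hg.1,
    (hf.memLp_deriv.add hg.memLp_deriv).ae_eq (hf.deriv_add hg).symm⟩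
  zero_mem' := memH1_of_lipschitzWith (C := 0) (LipschitzWith.const 0)
  smul_mem' c _ hf := memH1_iff.2 ⟨hf.1.const_smul c,
    (hf.memLp_deriv.const_smul c).ae_eq (hf.deriv_smul c).symm⟩

/-- The derivative as a linear map into `L^2`. -/
noncomputable def sobolevDeriv : sobolevH1 →ₗ[ℝ] Lp ℝ 2 (volume.restrict (Ioc (0 : ℝ) 1)) where
  toFun f := MemLp.toLp (deriv f) (MemH1.memLp_deriv f.2)
  map_add' f g := by
    rw [← MemLp.toLp_add, MemLp.toLp_eq_toLp_iff]
    exact MemH1.deriv_add f.2 g.2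
  map_smul' c f := by
    rw [RingHom.id_apply, ← MemLp.toLp_const_smul, MemLp.toLp_eq_toLp_iff]
    exact MemH1.deriv_smul c f.2

theorem sq_norm_toLp {f : ℝ → ℝ} (hf : MemLp f 2 (volume.restrict (Ioc (0 : ℝ) 1))) :
    ‖hf.toLp f‖ ^ 2 = ∫ t in Ioc (0 : ℝ) 1, f t ^ 2 := by
  rw [← real_inner_self_eq_norm_sq, L2.inner_def]
  refine integral_congr_ae ?_
  filter_upwards [hf.coeFn_toLp] with t ht
  rw [ht, real_inner_self_eq_norm_sq, Real.norm_eq_abs, sq_abs]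

theorem sq_norm_sobolevDeriv (f : sobolevH1) :
    ‖sobolevDeriv f‖ ^ 2 = dirichletEnergy f := by
  rw [dirichletEnergy_eq]
  exact sq_norm_toLp (MemH1.memLp_deriv f.2)

/-- The Dirichlet energy as a quadratic form on `H^1[0,1]`. -/
noncomputable def dirichletForm : QuadraticForm ℝ sobolevH1 :=
  LinearMap.BilinMap.toQuadraticMap ((innerₗ (Lp ℝ 2 (volume.restrict (Ioc (0 : ℝ) 1)))).compl₁₂
    sobolevDeriv sobolevDeriv)

theorem dirichletForm_apply (f : sobolevH1) : dirichletForm f = dirichletEnergy f := by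
  rw [← sq_norm_sobolevDeriv, ← real_inner_self_eq_norm_sq]
  rfl

/-- A pointwise limit of a sequence which is Cauchy for the Dirichlet energy is in `H^1`, and the
sequence converges to it in energy. -/
theorem memH1_of_cauchy {f : ℕ → ℝ → ℝ} {g : ℝ → ℝ} (hf : ∀ n, MemH1 (f n))
    (hlim : ∀ t ∈ Icc (0 : ℝ) 1, Tendsto (fun n => f n t) atTop (𝓝 (g t)))
    (hc : ∀ ε > 0, ∃ n₀, ∀ m ≥ n₀, ∀ n ≥ n₀, dirichletEnergy (f m - f n) < ε) :
    MemH1 g ∧ Tendsto (fun n => dirichletEnergy (f n - g)) atTop (𝓝 0) := by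
  let F : ℕ → Lp ℝ 2 (volume.restrict (Ioc (0 : ℝ) 1)) := fun n => sobolevDeriv ⟨f n, hf n⟩
  have hF : CauchySeq F := by
    rw [Metric.cauchySeq_iff]
    intro ε hε
    obtain ⟨n₀, h⟩ := hc (ε ^ 2) (by positivity)
    refine ⟨n₀, fun m hm n hn => ?_⟩
    rw [dist_eq_norm, ← map_sub]
    refine lt_of_pow_lt_pow_left₀ 2 hε.le ?_
    rw [sq_norm_sobolevDeriv]
    exact h m hm n hn
  obtain ⟨G, hG⟩ := cauchySeq_tendsto_of_complete hF
  have hGL : MemLp (G : ℝ → ℝ) 2 (volume.restrict (Ioc (0 : ℝ) 1)) := Lp.memLp G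
  have hGi : IntervalIntegrable G volume 0 1 :=
    (intervalIntegrable_iff_integrableOn_Ioc_of_le zero_le_one).2 (hGL.integrable (by norm_num))
  have hdiff : ∀ n, MemLp (deriv (f n) - ⇑G) 2 (volume.restrict (Ioc (0 : ℝ) 1)) :=
    fun n => (hf n).memLp_deriv.sub hGL
  have hnorm : ∀ n, ‖F n - G‖ ^ 2 = ∫ t in Ioc (0 : ℝ) 1, (deriv (f n) - ⇑G) t ^ 2 := by
    intro n
    rw [← sq_norm_toLp (hdiff n), MemLp.toLp_sub (hf n).memLp_deriv hGL, Lp.toLp_coeFn]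
    rfl
  have hto0 : Tendsto (fun n => ‖F n - G‖ ^ 2) atTop (𝓝 0) := by
    have := (tendsto_iff_norm_sub_tendsto_zero.1 hG).pow 2
    simpa using this
  -- The limit is a primitive of the `L^2` limit `G` of the derivatives: pass to the limit in the
  -- fundamental theorem of calculus, with Cauchy–Schwarz controlling the integrals.
  have hint : ∀ t ∈ Icc (0 : ℝ) 1, g t = g 0 + ∫ x in (0 : ℝ)..t, G x := by
    intro t ht
    have hsub : uIcc 0 t ⊆ uIcc (0 : ℝ) 1 := by
      rw [uIcc_of_le ht.1, uIcc_of_le zero_le_one]; exact Icc_subset_Icc_right ht.2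
    have h1 : Tendsto (fun n => f n t - f n 0) atTop (𝓝 (g t - g 0)) :=
      (hlim t ht).sub (hlim 0 (by simp))
    have h2 : Tendsto (fun n => f n t - f n 0) atTop (𝓝 (∫ x in (0 : ℝ)..t, G x)) := by
      rw [tendsto_iff_norm_sub_tendsto_zero]
      have h3 : ∀ n, ‖f n t - f n 0 - ∫ x in (0 : ℝ)..t, G x‖ ≤ ‖F n - G‖ := by
        intro n
        refine le_of_sq_le_sq ?_ (norm_nonneg _)
        rw [← (hf n).intervalIntegral_deriv (by simp) ht,
          ← intervalIntegral.integral_sub ((hf n).1.intervalIntegrable_deriv.mono_set hsub)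
            (hGi.mono_set hsub), Real.norm_eq_abs, sq_abs, hnorm]
        refine (sq_intervalIntegral_le (hdiff n) le_rfl ht.1 ht.2).trans ?_
        have : 0 ≤ ∫ x in Ioc (0 : ℝ) 1, (deriv (f n) - ⇑G) x ^ 2 :=
          integral_nonneg fun _ => sq_nonneg _
        nlinarith [ht.2]
      exact squeeze_zero (fun _ => norm_nonneg _) h3 (tendsto_iff_norm_sub_tendsto_zero.1 hG)
    linarith [tendsto_nhds_unique h1 h2]
  have hAC : AbsolutelyContinuousOnInterval g 0 1 := by
    refine (hGi.absolutelyContinuousOnInterval_intervalIntegral (c := 0) (by simp)).of_dist_le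
      fun x hx y hy => ?_
    rw [uIcc_of_le (zero_le_one' ℝ)] at hx hy
    rw [hint x hx, hint y hy, dist_add_left]
  have hder : deriv g =ᵐ[volume.restrict (Ioc (0 : ℝ) 1)] G := by
    have h1 := deriv_ae_eq_of_eqOn (f := g) (g := fun t => g 0 + ∫ x in (0 : ℝ)..t, G x) hint
    have h2 : ∀ᵐ t ∂(volume.restrict (Ioc (0 : ℝ) 1)),
        HasDerivAt (fun s => ∫ x in (0 : ℝ)..s, G x) (G t) t := by
      refine ae_restrict_unitInterval ?_
      filter_upwards [hGi.ae_hasDerivAt_integral] with t ht h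
      exact ht (by rw [uIcc_of_le zero_le_one]; exact Ioo_subset_Icc_self h) 0 (by simp)
    filter_upwards [h1, h2] with t h1 h2
    rw [h1, (h2.const_add (g 0)).deriv]
  have hg : MemH1 g := memH1_iff.2 ⟨hAC, hGL.ae_eq hder.symm⟩
  refine ⟨hg, hto0.congr fun n => ?_⟩
  have h4 : sobolevDeriv ⟨g, hg⟩ = G := by
    rw [← Lp.toLp_coeFn G hGL]
    exact (MemLp.toLp_eq_toLp_iff hg.memLp_deriv hGL).2 hder
  rw [← h4, ← map_sub, sq_norm_sobolevDeriv]
  rfl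

end SobolevInterval

/-! ### Monotone limits of quadratic forms -/

section MonotoneForms

variable {M : Type*} [AddCommGroup M] [Module ℝ M]

/-- For nonnegative forms this gives `Q (u + v) ≤ 2 Q u + 2 Q v`, which serves below in place of the
triangle inequality. -/
theorem QuadraticMap.parallelogram (Q : QuadraticForm ℝ M) (u v : M) :
    Q (u + v) + Q (u - v) = 2 * Q u + 2 * Q v := by
  have h1 := QuadraticMap.map_add Q u v
  have h2 := QuadraticMap.map_add Q u (-v)
  rw [QuadraticMap.polar_neg_right, QuadraticMap.map_neg, ← sub_eq_add_neg] at h2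
  linarith

/-- The vectors on which a sequence of nonnegative quadratic forms is bounded. -/
def boundedVectors (Q : ℕ → QuadraticForm ℝ M) (hQ : ∀ n u, 0 ≤ Q n u) : Submodule ℝ M where
  carrier := {u | ∃ C, ∀ n, Q n u ≤ C}
  add_mem' := by
    rintro u v ⟨a, ha⟩ ⟨b, hb⟩
    refine ⟨2 * a + 2 * b, fun n => ?_⟩
    have h1 := QuadraticMap.parallelogram (Q n) u v
    linarith [hQ n (u - v), ha n, hb n]
  zero_mem' := ⟨0, fun n => by rw [QuadraticMap.map_zero]⟩
  smul_mem' := by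
    rintro c u ⟨a, ha⟩
    refine ⟨c * c * a, fun n => ?_⟩
    rw [QuadraticMap.map_smul, smul_eq_mul]
    exact mul_le_mul_of_nonneg_left (ha n) (mul_self_nonneg c)

/-- A pointwise convergent sequence of quadratic forms converges to a quadratic form. -/
theorem QuadraticMap.exists_of_tendsto {Q : ℕ → QuadraticForm ℝ M} {q : M → ℝ}
    (h : ∀ u, Tendsto (fun n => Q n u) atTop (𝓝 (q u))) :
    ∃ Q' : QuadraticForm ℝ M, ∀ u, Q' u = q u := by
  have hpolar : ∀ u v, Tendsto (fun n => QuadraticMap.polar (Q n) u v) atTop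
      (𝓝 (QuadraticMap.polar q u v)) := fun u v => ((h (u + v)).sub (h u)).sub (h v)
  -- Homogeneity and bilinearity of the polar form are identities, hence survive pointwise limits.
  refine ⟨QuadraticMap.ofPolar q (fun a u => ?_) (fun u u' v => ?_) (fun a u v => ?_),
    fun u => rfl⟩
  · refine tendsto_nhds_unique (h (a • u)) ?_
    simpa only [QuadraticMap.map_smul] using (h u).const_smul (a * a)
  · refine tendsto_nhds_unique (hpolar _ _) ?_
    simpa only [QuadraticMap.polar_add_left] using (hpolar u v).add (hpolar u' v)
  · refine tendsto_nhds_unique (hpolar _ _) ?_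
    simpa only [QuadraticMap.polar_smul_left] using (hpolar u v).const_smul a

end MonotoneForms

/-! ### The resistance metric -/

section ResistanceMetric

variable {X : Type*} {dom : Set (X → ℝ)} {E : (X → ℝ) → ℝ}

theorem resistance_nonneg (x y : X) :
    0 ≤ resistance dom E x y := by
  refine Real.sSup_nonneg ?_
  rintro _ ⟨u, -, hu, rfl⟩
  positivity

/-- Functions of energy zero are not in the supremum, but they are constant, so the inequality holds
for them too. -/
theorem IsResistanceForm.sq_sub_le (h : IsResistanceForm dom E) {u : X → ℝ} (hu : u ∈ dom)
    (x y : X) : (u x - u y) ^ 2 ≤ resistance dom E x y * E u := by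
  rcases (h.nonneg u hu).eq_or_lt with h0 | h0
  · obtain ⟨a, rfl⟩ := (h.eq_zero_iff u hu).1 h0.symm
    simp [← h0]
  · rw [← div_le_iff₀ h0]
    refine le_csSup (h.finite_resistance x y) ⟨u, hu, h0, ?_⟩
    rw [sq_abs]

theorem resistance_le {x y : X} {r : ℝ} (hr : 0 ≤ r)
    (h : ∀ u ∈ dom, (u x - u y) ^ 2 ≤ r * E u) : resistance dom E x y ≤ r := by
  refine Real.sSup_le ?_ hr
  rintro _ ⟨u, hu, hE, rfl⟩
  rw [sq_abs, div_le_iff₀ hE]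
  exact h u hu

theorem resistance_self (x : X) : resistance dom E x x = 0 := by
  refine le_antisymm (resistance_le le_rfl fun u _ => by simp) (Real.sSup_nonneg ?_)
  rintro _ ⟨u, -, hu, rfl⟩
  positivity

theorem resistance_comm (x y : X) : resistance dom E x y = resistance dom E y x := by
  unfold resistance resistanceSet
  simp only [abs_sub_comm]

theorem IsResistanceForm.resistance_pos (h : IsResistanceForm dom E) {x y : X} (hxy : x ≠ y) :
    0 < resistance dom E x y := by
  refine (resistance_nonneg x y).lt_of_ne fun h0 => ?_
  obtain ⟨u, hu, hne⟩ := h.separates x y hxy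
  have := h.sq_sub_le hu x y
  rw [← h0, zero_mul] at this
  exact absurd this (not_le.2 (sq_pos_of_ne_zero (sub_ne_zero.2 hne)))

/-- From `(xy)^2 ≤ (an)(bp)` and the inequality of the means, the cross term satisfies `2xy ≤ an +
bp`, which is exactly what the expanded right side leaves over. -/
theorem sq_add_le_of_sq_le {a b p n x y : ℝ} (ha : 0 ≤ a) (hb : 0 ≤ b) (hp : 0 ≤ p) (hn : 0 ≤ n)
    (hx : x ^ 2 ≤ a * p) (hy : y ^ 2 ≤ b * n) : (x + y) ^ 2 ≤ (a + b) * (p + n) := by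
  have h1 : (2 * (x * y)) ^ 2 ≤ (a * n + b * p) ^ 2 := by
    have h2 : x ^ 2 * y ^ 2 ≤ a * p * (b * n) :=
      mul_le_mul hx hy (sq_nonneg y) (mul_nonneg ha hp)
    nlinarith [sq_nonneg (a * n - b * p)]
  have h3 := abs_le_of_sq_le_sq h1 (add_nonneg (mul_nonneg ha hn) (mul_nonneg hb hp))
  nlinarith [(le_abs_self _).trans h3]

/-- The triangle inequality for the resistance, if the positive and negative parts of a function
are in the domain and have at most the energy of the function in total. -/
theorem IsResistanceForm.resistance_triangle (h : IsResistanceForm dom E)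
    (hsplit : ∀ u ∈ dom, ∀ c : ℝ, (fun x => max (u x - c) 0) ∈ dom ∧
      (fun x => max (c - u x) 0) ∈ dom ∧
      E (fun x => max (u x - c) 0) + E (fun x => max (c - u x) 0) ≤ E u) (x y z : X) :
    resistance dom E x z ≤ resistance dom E x y + resistance dom E y z := by
  have ha := resistance_nonneg (dom := dom) (E := E) x y
  have hb := resistance_nonneg (dom := dom) (E := E) y z
  refine resistance_le (add_nonneg ha hb) fun u hu => ?_
  -- Cutting at the value `u y` makes both parts vanish at `y`.
  obtain ⟨hp, hn, hE⟩ := hsplit u hu (u y)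
  have hp0 := h.nonneg _ hp
  have hn0 := h.nonneg _ hn
  have h1 := h.sq_sub_le hp x y
  have h2 := h.sq_sub_le hn x y
  have h3 := h.sq_sub_le hp y z
  have h4 := h.sq_sub_le hn y z
  simp only [sub_self, max_self, sub_zero, zero_sub, neg_sq] at h1 h2 h3 h4
  refine le_trans ?_ (mul_le_mul_of_nonneg_left hE (add_nonneg ha hb))
  generalize E (fun x => max (u x - u y) 0) = p at *
  generalize E (fun x => max (u y - u x) 0) = n at *
  generalize resistance dom E x y = a at *
  generalize resistance dom E y z = b at *
  have hap := mul_nonneg ha hp0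
  have hbp := mul_nonneg hb hp0
  have han := mul_nonneg ha hn0
  have hbn := mul_nonneg hb hn0
  -- If `u x` and `u z` lie on the same side of `u y`, one part suffices, because `(s - t)^2 ≤ s^2 +
  -- t^2` for `s, t ≥ 0`. On opposite sides the two parts contribute one increment each and
  -- `sq_add_le_of_sq_le` combines them.
  rcases le_total (u y) (u x) with hx | hx <;> rcases le_total (u y) (u z) with hz | hz
  · rw [max_eq_left (sub_nonneg.2 hx)] at h1
    rw [max_eq_left (sub_nonneg.2 hz)] at h3
    nlinarith [mul_nonneg (sub_nonneg.2 hx) (sub_nonneg.2 hz)]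
  · rw [max_eq_left (sub_nonneg.2 hx)] at h1
    rw [max_eq_left (sub_nonneg.2 hz)] at h4
    have := sq_add_le_of_sq_le ha hb hp0 hn0 h1 h4
    rwa [sub_add_sub_cancel] at this
  · rw [max_eq_left (sub_nonneg.2 hx)] at h2
    rw [max_eq_left (sub_nonneg.2 hz)] at h3
    have := sq_add_le_of_sq_le ha hb hn0 hp0 h2 h3
    rw [add_comm n p, add_comm (u y - u x), sub_add_sub_cancel] at this
    nlinarith
  · rw [max_eq_left (sub_nonneg.2 hx)] at h2
    rw [max_eq_left (sub_nonneg.2 hz)] at h4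
    nlinarith [mul_nonneg (sub_nonneg.2 hx) (sub_nonneg.2 hz)]

/-- The resistance metric. -/
theorem IsResistanceForm.exists_metricSpace (h : IsResistanceForm dom E)
    (hsplit : ∀ u ∈ dom, ∀ c : ℝ, (fun x => max (u x - c) 0) ∈ dom ∧
      (fun x => max (c - u x) 0) ∈ dom ∧
      E (fun x => max (u x - c) 0) + E (fun x => max (c - u x) 0) ≤ E u) :
    ∃ m : MetricSpace X, ∀ x y, m.dist x y = resistance dom E x y :=
  ⟨{ dist := resistance dom E
     dist_self := resistance_self
     dist_comm := resistance_comm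
     dist_triangle := h.resistance_triangle hsplit
     eq_of_dist_eq_zero := fun {x y} h0 => by
       by_contra hne
       exact (h.resistance_pos hne).ne' h0 }, fun _ _ => rfl⟩

/-- The identity is a continuous map from a compact to a Hausdorff space, hence closed. -/
theorem TopologicalSpace.eq_of_le_of_compact_of_t2 {X : Type*} {t₁ t₂ : TopologicalSpace X}
    (h₁ : @CompactSpace X t₁) (h₂ : @T2Space X t₂) (h : t₁ ≤ t₂) : t₂ = t₁ := by
  refine le_antisymm (fun s hs => ?_) h
  have hcl := @Continuous.isClosedMap X X t₁ t₂ h₁ h₂ id (continuous_id_iff_le.2 h)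
  have := hcl sᶜ (@IsOpen.isClosed_compl X t₁ s hs)
  rw [Set.image_id] at this
  simpa using (@IsClosed.isOpen_compl X t₂ sᶜ this)

/-- A metric on a compact space for which the identity is continuous induces the topology. -/
theorem MetricSpace.toTopologicalSpace_eq_of_compact {X : Type*} [t : TopologicalSpace X]
    [CompactSpace X] (m : MetricSpace X)
    (h : ∀ x : X, ∀ ε > 0, ∀ᶠ y in 𝓝 x, m.dist y x < ε) :
    m.toPseudoMetricSpace.toUniformSpace.toTopologicalSpace = t := by
  refine TopologicalSpace.eq_of_le_of_compact_of_t2 ‹_› ?_ (continuous_id_iff_le.1 ?_)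
  · infer_instance
  · refine (@continuous_iff_continuousAt X X t
      m.toPseudoMetricSpace.toUniformSpace.toTopologicalSpace id).2 fun x => ?_
    exact (@Metric.tendsto_nhds X X m.toPseudoMetricSpace _ _ _).2 fun ε hε => h x ε hε

end ResistanceMetric

/-! ### Words and cells -/

theorem wordMap_append {X : Type*} {N : ℕ} (F : Fin N → X → X) (w v : List (Fin N)) :
    wordMap F (w ++ v) = wordMap F w ∘ wordMap F v := by
  induction w with
  | nil => rfl
  | cons i w ih => simp [wordMap, ih, Function.comp_assoc]

theorem wordMap_singleton {X : Type*} {N : ℕ} (F : Fin N → X → X) (i : Fin N) :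
    wordMap F [i] = F i := rfl

theorem wordMap_mem {X : Type*} {N : ℕ} {F : Fin N → X → X} {K : Set X}
    (h : ∀ i, ∀ x ∈ K, F i x ∈ K) (w : List (Fin N)) {x : X} (hx : x ∈ K) :
    wordMap F w x ∈ K := by
  induction w with
  | nil => exact hx
  | cons i w ih => exact h i _ ih

theorem dist_wordMap_le {X : Type*} [PseudoMetricSpace X] {N : ℕ} {F : Fin N → X → X} {a : ℝ}
    (ha : 0 ≤ a) (h : ∀ i x y, dist (F i x) (F i y) ≤ a * dist x y) (w : List (Fin N)) (x y : X) :
    dist (wordMap F w x) (wordMap F w y) ≤ a ^ w.length * dist x y := by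
  induction w with
  | nil => simp [wordMap]
  | cons i w ih =>
    calc dist (wordMap F (i :: w) x) (wordMap F (i :: w) y)
        ≤ a * dist (wordMap F w x) (wordMap F w y) := h i _ _
      _ ≤ a * (a ^ w.length * dist x y) := by gcongr
      _ = a ^ (i :: w).length * dist x y := by rw [List.length_cons]; ring

/-- The fixed point of a contraction lies in every nonempty closed invariant set. -/
theorem IsClosed.fixedPt_mem {X : Type*} [PseudoMetricSpace X] {f : X → X} {q : X} {K : Set X}
    {a : ℝ} (hK : IsClosed K) (hne : K.Nonempty) (ha : 0 ≤ a) (ha₁ : a < 1)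
    (hf : ∀ x y, dist (f x) (f y) ≤ a * dist x y) (hq : f q = q) (hfK : ∀ x ∈ K, f x ∈ K) :
    q ∈ K := by
  obtain ⟨x, hx⟩ := hne
  have hmem : ∀ n, f^[n] x ∈ K := by
    intro n
    induction n with
    | zero => exact hx
    | succ n ih => rw [Function.iterate_succ_apply']; exact hfK _ ih
  have hdist : ∀ n, dist (f^[n] x) q ≤ a ^ n * dist x q := by
    intro n
    induction n with
    | zero => simp
    | succ n ih =>
      rw [Function.iterate_succ_apply']
      calc dist (f (f^[n] x)) q = dist (f (f^[n] x)) (f q) := by rw [hq]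
        _ ≤ a * dist (f^[n] x) q := hf _ _
        _ ≤ a * (a ^ n * dist x q) := by gcongr
        _ = a ^ (n + 1) * dist x q := by ring
  have hlim : Tendsto (fun n => f^[n] x) atTop (𝓝 q) := by
    rw [tendsto_iff_dist_tendsto_zero]
    refine squeeze_zero (fun _ => dist_nonneg) hdist ?_
    simpa using (tendsto_pow_atTop_nhds_zero_of_lt_one ha ha₁).mul_const (dist x q)
  exact hK.mem_of_tendsto hlim (Eventually.of_forall hmem)

/-! ### Geometry of the cells and of the stretched fractal -/

namespace SelfSimilarSet

variable {d N : ℕ} (S : SelfSimilarSet d N)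

theorem map_mem_carrier (i : Fin N) (x : EuclideanSpace ℝ (Fin d)) (hx : x ∈ S.carrier) :
    S.map i x ∈ S.carrier := by
  rw [S.carrier_eq]
  exact Set.mem_iUnion.2 ⟨i, x, hx, rfl⟩

theorem map_injective (i : Fin N) : Function.Injective (S.map i) := fun x y h => by
  have h1 := S.dist_map i x y
  rw [h, dist_self] at h1
  exact dist_eq_zero.1 ((mul_eq_zero.1 h1.symm).resolve_left (S.ratio_pos i).ne')

theorem continuous_map (i : Fin N) : Continuous (S.map i) :=
  (LipschitzWith.of_dist_le_mul (K := ⟨S.ratio i, (S.ratio_pos i).le⟩)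
    fun x y => (S.dist_map i x y).le).continuous

theorem fixedPt_mem_carrier (i : Fin N) : S.fixedPt i ∈ S.carrier :=
  S.isCompact_carrier.isClosed.fixedPt_mem S.isConnected_carrier.nonempty (S.ratio_pos i).le
    (S.ratio_lt_one i) (fun x y => (S.dist_map i x y).le) (S.map_fixedPt i) (S.map_mem_carrier i)

/-- Any two 1-cells are joined by a chain of 1-cells, in which consecutive ones intersect. -/
theorem reflTransGen_cells (i j : Fin N) : Relation.ReflTransGen
    (fun a b => a ≠ b ∧ (S.map a '' S.carrier ∩ S.map b '' S.carrier).Nonempty) i j := by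
  by_contra hj
  set r := fun a b : Fin N =>
    a ≠ b ∧ (S.map a '' S.carrier ∩ S.map b '' S.carrier).Nonempty with hr
  have hclosed : ∀ s : Set (Fin N), IsClosed (⋃ a ∈ s, S.map a '' S.carrier) := fun s =>
    s.toFinite.isClosed_biUnion fun a _ =>
      (S.isCompact_carrier.image (S.continuous_map a)).isClosed
  -- The cells reachable from `i` and the others form two closed sets covering the connected
  -- carrier, so they meet; a common point is a link that makes an unreachable cell reachable.
  let I : Set (Fin N) := {a | Relation.ReflTransGen r i a}
  have hcover : S.carrier ⊆ (⋃ a ∈ I, S.map a '' S.carrier) ∪ ⋃ a ∈ Iᶜ, S.map a '' S.carrier := by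
    intro x hx
    rw [S.carrier_eq] at hx
    obtain ⟨a, ha⟩ := Set.mem_iUnion.1 hx
    by_cases h : a ∈ I
    · exact Or.inl (Set.mem_biUnion h ha)
    · exact Or.inr (Set.mem_biUnion h ha)
  have hne : ∀ (s : Set (Fin N)) (a : Fin N), a ∈ s →
      (S.carrier ∩ ⋃ a ∈ s, S.map a '' S.carrier).Nonempty := by
    intro s a ha
    exact ⟨S.fixedPt a, S.fixedPt_mem_carrier a,
      Set.mem_biUnion ha ⟨S.fixedPt a, S.fixedPt_mem_carrier a, S.map_fixedPt a⟩⟩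
  obtain ⟨x, -, hx₁, hx₂⟩ := isPreconnected_closed_iff.1 S.isConnected_carrier.isPreconnected _ _
    (hclosed I) (hclosed Iᶜ) hcover (hne I i Relation.ReflTransGen.refl) (hne Iᶜ j hj)
  obtain ⟨a, ha, hxa⟩ := Set.mem_iUnion₂.1 hx₁
  obtain ⟨b, hb, hxb⟩ := Set.mem_iUnion₂.1 hx₂
  refine hb (Relation.ReflTransGen.tail ha ⟨?_, x, hxa, hxb⟩)
  rintro rfl
  exact hb ha

theorem mem_postCritical_of_map_mem {i : Fin N} {x : EuclideanSpace ℝ (Fin d)}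
    (hx : x ∈ S.carrier) (h : S.map i x ∈ S.critical) : x ∈ S.postCritical :=
  ⟨hx, [i], by simp, h⟩

end SelfSimilarSet

namespace StretchableSet

variable {d N : ℕ} {S : StretchableSet d N}

/-- Two intersecting 1-cells are joined by two connecting lines with a common start. -/
theorem exists_lineIndex {i j : Fin N} (hij : i ≠ j)
    (h : (S.map i '' S.carrier ∩ S.map j '' S.carrier).Nonempty) :
    ∃ l l' : S.LineIndex, l.1.1 = i ∧ l'.1.1 = j ∧ S.lineStart l = S.lineStart l' := by
  obtain ⟨x, ⟨p, hp, rfl⟩, ⟨p', hp', hpp'⟩⟩ := h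
  have hc : S.map i p ∈ S.critical := ⟨i, j, hij, ⟨p, hp, rfl⟩, ⟨p', hp', hpp'⟩⟩
  have hc' : S.map j p' ∈ S.critical := hpp' ▸ hc
  exact ⟨⟨(i, ⟨p, S.mem_postCritical_of_map_mem hp hc⟩), hc⟩,
    ⟨(j, ⟨p', S.mem_postCritical_of_map_mem hp' hc'⟩), hc'⟩, rfl, rfl, hpp'.symm⟩

theorem dist_stretch {α : ℝ} (hα : 0 ≤ α) (i : Fin N) (x y : EuclideanSpace ℝ (Fin d)) :
    dist (S.stretch α i x) (S.stretch α i y) ≤ α * dist x y := by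
  have h : dist (S.stretch α i x) (S.stretch α i y) = α * dist (S.map i x) (S.map i y) := by
    rw [stretch, stretch, dist_add_right, dist_smul₀, dist_sub_right, Real.norm_of_nonneg hα]
  rw [h, S.dist_map]
  have := S.ratio_lt_one i
  have := mul_le_mul_of_nonneg_right this.le (dist_nonneg (x := x) (y := y))
  gcongr
  linarith

theorem stretch_fixedPt (α : ℝ) (i : Fin N) : S.stretch α i (S.fixedPt i) = S.fixedPt i := by
  simp [stretch, S.map_fixedPt]

theorem dist_wordMap_stretch_le {α : ℝ} (hα : 0 ≤ α) (w : List (Fin N))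
    (x y : EuclideanSpace ℝ (Fin d)) :
    dist (wordMap (S.stretch α) w x) (wordMap (S.stretch α) w y) ≤ α ^ w.length * dist x y :=
  dist_wordMap_le hα (fun i => S.dist_stretch hα i) w x y

theorem continuous_wordMap_stretch {α : ℝ} (hα : 0 ≤ α) (w : List (Fin N)) :
    Continuous (wordMap (S.stretch α) w) :=
  (LipschitzWith.of_dist_le_mul (K := ⟨α ^ w.length, pow_nonneg hα _⟩)
    fun x y => S.dist_wordMap_stretch_le hα w x y).continuous

theorem IsFractalPart.fixedPt_mem {α : ℝ} (hα₀ : 0 ≤ α) (hα₁ : α < 1)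
    {A : Set (EuclideanSpace ℝ (Fin d))} (hA : S.IsFractalPart α A) (i : Fin N) :
    S.fixedPt i ∈ A := by
  refine hA.1.isClosed.fixedPt_mem hA.2.1 hα₀ hα₁ (S.dist_stretch hα₀ i) (S.stretch_fixedPt α i)
    fun x hx => ?_
  rw [hA.2.2]
  exact Set.mem_iUnion.2 ⟨i, x, hx, rfl⟩

theorem IsFractalPart.wordMap_mem {α : ℝ} {A : Set (EuclideanSpace ℝ (Fin d))}
    (hA : S.IsFractalPart α A) (w : List (Fin N)) {x : EuclideanSpace ℝ (Fin d)} (hx : x ∈ A) :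
    wordMap (S.stretch α) w x ∈ A := by
  refine _root_.wordMap_mem (fun i x hx => ?_) w hx
  rw [hA.2.2]
  exact Set.mem_iUnion.2 ⟨i, x, hx, rfl⟩

namespace Addressing

variable (T : S.Addressing)

/-- A post critical fixed point is addressed by itself. -/
theorem word_fixedPt {k : Fin N} (hk : S.fixedPt k ∈ S.postCritical) :
    T.word ⟨S.fixedPt k, hk⟩ = [] := by
  set p : S.postCritical := ⟨S.fixedPt k, hk⟩ with hp
  rcases hw : T.word p with _ | ⟨i, w⟩
  · rfl
  exfalso
  have hpw := T.wordMap_eq p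
  rw [hw] at hpw
  change S.map i (wordMap S.map w (S.fixedPt (T.letter p))) = S.fixedPt k at hpw
  have hmem : wordMap S.map w (S.fixedPt (T.letter p)) ∈ S.carrier :=
    wordMap_mem S.map_mem_carrier w (S.fixedPt_mem_carrier _)
  -- An address starting with `i ≠ k` would put `q_k` in two different 1-cells.
  have hik : i = k := by
    by_contra hne
    exact S.fixedPt_notMem_critical k ⟨i, k, hne, ⟨_, hmem, hpw⟩,
      ⟨_, S.fixedPt_mem_carrier k, S.map_fixedPt k⟩⟩
  subst hik
  -- Removing the first letter leaves an address of the same fixed point, so compatibility forces `w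
  -- = i :: w`, which is impossible by length.
  have hfix : S.fixedPt i = wordMap S.map w (S.fixedPt (T.letter p)) :=
    S.map_injective i ((S.map_fixedPt i).trans hpw.symm)
  have := (T.tail p p i w hw hfix).1
  rw [hw] at this
  simpa using congrArg List.length this

/-- This makes `q_k` usable as a base point: it is a vertex, so graph energies of cells control
differences to it. -/
theorem vertex_fixedPt (α : ℝ) {k : Fin N} (hk : S.fixedPt k ∈ S.postCritical) :
    T.vertex α ⟨S.fixedPt k, hk⟩ = S.fixedPt k := by
  have hw := T.word_fixedPt hk
  have h := T.wordMap_eq ⟨S.fixedPt k, hk⟩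
  rw [hw] at h
  rw [vertex, hw]
  exact h

theorem lineEnd_eq (α : ℝ) (l : S.LineIndex) :
    T.lineEnd α l = S.stretch α l.1.1 (T.vertex α l.1.2) := rfl

theorem linePath_zero (α : ℝ) (l : S.LineIndex) : T.linePath α l 0 = S.lineStart l := by
  simp [linePath]

theorem linePath_one (α : ℝ) (l : S.LineIndex) : T.linePath α l 1 = T.lineEnd α l := by
  simp [linePath]

theorem continuous_linePath (α : ℝ) (l : S.LineIndex) : Continuous (T.linePath α l) := by
  unfold linePath
  fun_prop

theorem lipschitzWith_linePath (α : ℝ) (l : S.LineIndex) :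
    LipschitzWith (nndist (T.lineEnd α l) (S.lineStart l)) (T.linePath α l) := by
  refine LipschitzWith.of_dist_le_mul fun s t => ?_
  have : T.linePath α l s - T.linePath α l t = (s - t) • (T.lineEnd α l - S.lineStart l) := by
    unfold linePath
    module
  rw [dist_eq_norm, this, norm_smul, coe_nndist, dist_eq_norm, dist_eq_norm, mul_comm]

variable {T} {α : ℝ} {K : Set (EuclideanSpace ℝ (Fin d))}

namespace IsStretchedFractal

theorem stretch_mem (hK : T.IsStretchedFractal α K) (i : Fin N) (x : EuclideanSpace ℝ (Fin d))
    (hx : x ∈ K) : S.stretch α i x ∈ K := by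
  rw [hK.2.2]
  exact Or.inl (Set.mem_iUnion.2 ⟨i, x, hx, rfl⟩)

theorem linePath_mem (hK : T.IsStretchedFractal α K) (l : S.LineIndex) {t : ℝ}
    (ht : t ∈ Set.Icc (0 : ℝ) 1) : T.linePath α l t ∈ K := by
  rw [hK.2.2]
  exact Or.inr (Set.mem_iUnion.2 ⟨l, t, ht, rfl⟩)

theorem wordMap_mem (hK : T.IsStretchedFractal α K) (w : List (Fin N))
    {x : EuclideanSpace ℝ (Fin d)} (hx : x ∈ K) : wordMap (S.stretch α) w x ∈ K :=
  _root_.wordMap_mem hK.stretch_mem w hx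

theorem fixedPt_mem (hK : T.IsStretchedFractal α K) (hα₀ : 0 ≤ α) (hα₁ : α < 1) (i : Fin N) :
    S.fixedPt i ∈ K :=
  hK.1.isClosed.fixedPt_mem hK.2.1 hα₀ hα₁ (S.dist_stretch hα₀ i) (S.stretch_fixedPt α i)
    (hK.stretch_mem i)

theorem vertex_mem (hK : T.IsStretchedFractal α K) (hα₀ : 0 ≤ α) (hα₁ : α < 1)
    (p : S.postCritical) : T.vertex α p ∈ K :=
  hK.wordMap_mem _ (hK.fixedPt_mem hα₀ hα₁ _)

/-- Every point is in a cell of level `n` or on a connecting line of a smaller level. -/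
theorem mem_cell_or_line (hK : T.IsStretchedFractal α K) (n : ℕ) {x : EuclideanSpace ℝ (Fin d)}
    (hx : x ∈ K) : (∃ w : List (Fin N), w.length = n ∧ ∃ y ∈ K, wordMap (S.stretch α) w y = x) ∨
      ∃ w : List (Fin N), w.length < n ∧ ∃ l, ∃ t ∈ Set.Icc (0 : ℝ) 1,
        wordMap (S.stretch α) w (T.linePath α l t) = x := by
  induction n with
  | zero => exact Or.inl ⟨[], rfl, x, hx, rfl⟩
  | succ n ih =>
    rcases ih with ⟨w, hw, y, hy, rfl⟩ | ⟨w, hw, h⟩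
    · rw [hK.2.2] at hy
      rcases hy with hy | hy
      · obtain ⟨i, z, hz, rfl⟩ := Set.mem_iUnion.1 hy
        refine Or.inl ⟨w ++ [i], by simp [hw], z, hz, ?_⟩
        rw [wordMap_append]
        rfl
      · obtain ⟨l, t, ht, rfl⟩ := Set.mem_iUnion.1 hy
        exact Or.inr ⟨w, by omega, l, t, ht, rfl⟩
    · exact Or.inr ⟨w, by omega, h⟩

end IsStretchedFractal

end Addressing

end StretchableSet

namespace StretchableSet.Addressing

variable {d N : ℕ} {S : StretchableSet d N} {T : S.Addressing} {α : ℝ}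
  {K : Set (EuclideanSpace ℝ (Fin d))} {r₀ : S.postCritical → S.postCritical → ENNReal}

/-! ### Estimates for the level energies -/

/-- `f` is in `H^1` along all connecting lines of all levels. -/
def LinewiseH1 (T : S.Addressing) (α : ℝ) (f : EuclideanSpace ℝ (Fin d) → ℝ) : Prop :=
  ∀ (w : List (Fin N)) (l : S.LineIndex), MemH1 (f ∘ wordMap (S.stretch α) w ∘ T.linePath α l)

theorem fractalEnergy_nonneg (f : EuclideanSpace ℝ (Fin d) → ℝ) : 0 ≤ T.fractalEnergy α r₀ f := by
  unfold fractalEnergy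
  positivity

theorem lineEnergy_nonneg {ρ : S.LineIndex → ℝ} (hρ : ∀ l, 0 < ρ l)
    (f : EuclideanSpace ℝ (Fin d) → ℝ) : 0 ≤ T.lineEnergy α ρ f :=
  Finset.sum_nonneg fun l _ => mul_nonneg (inv_nonneg.2 (hρ l).le) (dirichletEnergy_nonneg _)

/-- Among the functions with given end values the affine one has least Dirichlet energy; this is the
Hölder bound between `0` and `1`. -/
theorem connectingEnergy_le_lineEnergy {ρ : S.LineIndex → ℝ} (hρ : ∀ l, 0 < ρ l)
    {f : EuclideanSpace ℝ (Fin d) → ℝ} (hf : ∀ l, MemH1 (f ∘ T.linePath α l)) :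
    T.connectingEnergy α ρ f ≤ T.lineEnergy α ρ f := by
  refine Finset.sum_le_sum fun l _ => mul_le_mul_of_nonneg_left ?_ (inv_nonneg.2 (hρ l).le)
  have := (hf l).sq_sub_le (s := 1) (t := 0) (by simp) (by simp)
  simpa [linePath_zero, linePath_one] using this

/-- `f` is itself a competitor in the infimum that defines the trace. -/
theorem IsHarmonicStructure.fractalEnergy_le {lam : ℝ} {ρ : S.LineIndex → ℝ}
    (h : T.IsHarmonicStructure α r₀ lam ρ) {f : EuclideanSpace ℝ (Fin d) → ℝ}
    (hf : ∀ l, MemH1 (f ∘ T.linePath α l)) :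
    T.fractalEnergy α r₀ f ≤
      lam⁻¹ * ∑ i, T.fractalEnergy α r₀ (f ∘ S.stretch α i) + T.lineEnergy α ρ f := by
  refine ((h.trace f).1 ⟨f, fun _ => rfl, rfl⟩).trans ?_
  rw [firstEnergy, ← Finset.mul_sum]
  exact add_le_add_right (connectingEnergy_le_lineEnergy h.rho_pos hf) _

/-- The last letter is split off, because the cell of `w` is refined into the cells of the words `w
i`. -/
theorem sum_words_succ (n : ℕ) (φ : List (Fin N) → ℝ) :
    ∑ w : Fin (n + 1) → Fin N, φ (List.ofFn w) =
      ∑ w : Fin n → Fin N, ∑ i, φ (List.ofFn w ++ [i]) := by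
  rw [← (Fin.snocEquiv fun _ => Fin N).sum_comp, Fintype.sum_prod_type_right]
  refine Finset.sum_congr rfl fun w _ => Finset.sum_congr rfl fun i _ => ?_
  congr 1
  rw [List.ofFn_succ', List.concat_eq_append]
  simp [Fin.snocEquiv]

variable {lam : ℕ → ℝ} {ρ : ℕ → S.LineIndex → ℝ}

theorem IsRegularSequence.prod_pos (hR : T.IsRegularSequence α r₀ lam ρ) (n : ℕ) :
    0 < ∏ j ∈ Finset.range n, lam j :=
  Finset.prod_pos fun k _ => (hR.harmonic k).lam_pos

/-- Apply the previous inequality for the structure with index `n` in every cell of level `n`: its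
graph energy is replaced by those of the subcells, rescaled by `1 / lam n`, plus the new lines. -/
theorem IsRegularSequence.levelEnergy_mono (hR : T.IsRegularSequence α r₀ lam ρ)
    {f : EuclideanSpace ℝ (Fin d) → ℝ} (hf : T.LinewiseH1 α f) :
    Monotone fun n => T.levelEnergy α r₀ lam ρ n f := by
  refine monotone_nat_of_le_succ fun n => ?_
  simp only [levelEnergy]
  rw [Finset.sum_range_succ, ← add_assoc, add_right_comm]
  refine add_le_add_left ?_ _
  rw [sum_words_succ n fun w => T.fractalEnergy α r₀ (f ∘ wordMap (S.stretch α) w),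
    Finset.prod_range_succ, mul_inv, mul_assoc, ← mul_add]
  refine mul_le_mul_of_nonneg_left ?_ (inv_nonneg.2 (hR.prod_pos n).le)
  rw [Finset.mul_sum, ← Finset.sum_add_distrib]
  refine Finset.sum_le_sum fun w _ => ?_
  have := (hR.harmonic n).fractalEnergy_le (f := f ∘ wordMap (S.stretch α) (List.ofFn w))
    (fun l => hf _ l)
  simpa only [wordMap_append, wordMap_singleton, Function.comp_assoc] using this

theorem IsRegularSequence.lineTerm_nonneg (hR : T.IsRegularSequence α r₀ lam ρ) (k : ℕ)
    (f : EuclideanSpace ℝ (Fin d) → ℝ) :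
    0 ≤ (∏ j ∈ Finset.range k, lam j)⁻¹ *
      ∑ w : Fin k → Fin N, T.lineEnergy α (ρ k) (f ∘ wordMap (S.stretch α) (List.ofFn w)) :=
  mul_nonneg (inv_nonneg.2 (hR.prod_pos k).le)
    (Finset.sum_nonneg fun _ _ => lineEnergy_nonneg (hR.harmonic k).rho_pos _)

theorem IsRegularSequence.fractalTerm_nonneg (hR : T.IsRegularSequence α r₀ lam ρ) (k : ℕ)
    (f : EuclideanSpace ℝ (Fin d) → ℝ) :
    0 ≤ (∏ j ∈ Finset.range k, lam j)⁻¹ *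
      ∑ w : Fin k → Fin N, T.fractalEnergy α r₀ (f ∘ wordMap (S.stretch α) (List.ofFn w)) :=
  mul_nonneg (inv_nonneg.2 (hR.prod_pos k).le)
    (Finset.sum_nonneg fun _ _ => fractalEnergy_nonneg _)

theorem IsRegularSequence.levelEnergy_nonneg (hR : T.IsRegularSequence α r₀ lam ρ) (n : ℕ)
    (f : EuclideanSpace ℝ (Fin d) → ℝ) : 0 ≤ T.levelEnergy α r₀ lam ρ n f :=
  add_nonneg (hR.fractalTerm_nonneg n f) (Finset.sum_nonneg fun k _ => hR.lineTerm_nonneg k f)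

/-- The left side is one of the nonnegative summands of the level energy, `w.get` being the word as
a function. -/
theorem IsRegularSequence.fractalEnergy_cell_le (hR : T.IsRegularSequence α r₀ lam ρ)
    (w : List (Fin N)) (f : EuclideanSpace ℝ (Fin d) → ℝ) :
    T.fractalEnergy α r₀ (f ∘ wordMap (S.stretch α) w) ≤
      (∏ j ∈ Finset.range w.length, lam j) * T.levelEnergy α r₀ lam ρ w.length f := by
  rw [← div_le_iff₀' (hR.prod_pos _), div_eq_inv_mul]
  refine le_trans (mul_le_mul_of_nonneg_left ?_ (inv_nonneg.2 (hR.prod_pos _).le))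
    (le_add_of_nonneg_right (Finset.sum_nonneg fun k _ => hR.lineTerm_nonneg k f))
  have := Finset.single_le_sum (f := fun v : Fin w.length → Fin N =>
    T.fractalEnergy α r₀ (f ∘ wordMap (S.stretch α) (List.ofFn v)))
    (fun _ _ => fractalEnergy_nonneg _) (Finset.mem_univ w.get)
  simpa only [List.ofFn_get] using this

/-- The lines in the cell of `w` first appear in the energy of level `w.length + 1`, but with the
scaling factor of level `w.length`. -/
theorem IsRegularSequence.dirichletEnergy_line_le (hR : T.IsRegularSequence α r₀ lam ρ)
    (w : List (Fin N)) (l : S.LineIndex) (f : EuclideanSpace ℝ (Fin d) → ℝ) :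
    dirichletEnergy (f ∘ wordMap (S.stretch α) w ∘ T.linePath α l) ≤
      ρ w.length l * ((∏ j ∈ Finset.range w.length, lam j) *
        T.levelEnergy α r₀ lam ρ (w.length + 1) f) := by
  have hρ := (hR.harmonic w.length).rho_pos
  rw [← div_le_iff₀' (hρ l), div_eq_inv_mul, ← div_le_iff₀' (hR.prod_pos _),
    div_eq_inv_mul]
  have h1 := Finset.single_le_sum (f := fun l : S.LineIndex => (ρ w.length l)⁻¹ *
    dirichletEnergy ((f ∘ wordMap (S.stretch α) w) ∘ T.linePath α l))
    (fun l _ => mul_nonneg (inv_nonneg.2 (hρ l).le) (dirichletEnergy_nonneg _)) (Finset.mem_univ l)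
  have h2 := Finset.single_le_sum (f := fun v : Fin w.length → Fin N =>
    T.lineEnergy α (ρ w.length) (f ∘ wordMap (S.stretch α) (List.ofFn v)))
    (fun _ _ => lineEnergy_nonneg hρ _) (Finset.mem_univ w.get)
  simp only [List.ofFn_get] at h2
  have h3 := Finset.single_le_sum (f := fun k : ℕ => (∏ j ∈ Finset.range k, lam j)⁻¹ *
      ∑ w : Fin k → Fin N, T.lineEnergy α (ρ k) (f ∘ wordMap (S.stretch α) (List.ofFn w)))
    (fun k _ => hR.lineTerm_nonneg k f) (Finset.self_mem_range_succ w.length)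
  refine le_trans ?_ (le_add_of_nonneg_left (hR.fractalTerm_nonneg _ f))
  refine le_trans ?_ h3
  exact mul_le_mul_of_nonneg_left (h1.trans h2) (inv_nonneg.2 (hR.prod_pos _).le)

/-! ### Contractions -/

theorem fractalEnergy_add_le {f g u : EuclideanSpace ℝ (Fin d) → ℝ}
    (h : ∀ p p', (f (T.vertex α p) - f (T.vertex α p')) ^ 2 +
      (g (T.vertex α p) - g (T.vertex α p')) ^ 2 ≤ (u (T.vertex α p) - u (T.vertex α p')) ^ 2) :
    T.fractalEnergy α r₀ f + T.fractalEnergy α r₀ g ≤ T.fractalEnergy α r₀ u := by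
  simp only [fractalEnergy]
  rw [← mul_add, ← Finset.sum_add_distrib]
  gcongr with p
  rw [← Finset.sum_add_distrib]
  gcongr with p'
  rw [← mul_add]
  gcongr
  exact h p p'

theorem LinewiseH1.of_sq_add_sq_le (hK : T.IsStretchedFractal α K)
    {f g u : EuclideanSpace ℝ (Fin d) → ℝ} (hu : T.LinewiseH1 α u)
    (h : ∀ x ∈ K, ∀ y ∈ K, (f x - f y) ^ 2 + (g x - g y) ^ 2 ≤ (u x - u y) ^ 2) :
    T.LinewiseH1 α f ∧ T.LinewiseH1 α g ∧ ∀ w l,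
      dirichletEnergy (f ∘ wordMap (S.stretch α) w ∘ T.linePath α l) +
        dirichletEnergy (g ∘ wordMap (S.stretch α) w ∘ T.linePath α l) ≤
      dirichletEnergy (u ∘ wordMap (S.stretch α) w ∘ T.linePath α l) := by
  have key := fun w l => (hu w l).of_sq_add_sq_le
    (f := f ∘ wordMap (S.stretch α) w ∘ T.linePath α l)
    (g := g ∘ wordMap (S.stretch α) w ∘ T.linePath α l) fun s hs t ht =>
      h _ (hK.wordMap_mem w (hK.linePath_mem l hs)) _ (hK.wordMap_mem w (hK.linePath_mem l ht))
  exact ⟨fun w l => (key w l).1, fun w l => (key w l).2.1, fun w l => (key w l).2.2⟩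

/-- Every summand, a squared difference or a Dirichlet integral, respects the domination of
increments. Treating two functions at once provides both contractions and splittings. -/
theorem IsRegularSequence.levelEnergy_add_le (hR : T.IsRegularSequence α r₀ lam ρ)
    (hα₀ : 0 ≤ α) (hα₁ : α < 1) (hK : T.IsStretchedFractal α K)
    {f g u : EuclideanSpace ℝ (Fin d) → ℝ} (hu : T.LinewiseH1 α u)
    (h : ∀ x ∈ K, ∀ y ∈ K, (f x - f y) ^ 2 + (g x - g y) ^ 2 ≤ (u x - u y) ^ 2) (n : ℕ) :
    T.levelEnergy α r₀ lam ρ n f + T.levelEnergy α r₀ lam ρ n g ≤ T.levelEnergy α r₀ lam ρ n u := by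
  obtain ⟨-, -, hd⟩ := hu.of_sq_add_sq_le hK h
  simp only [levelEnergy]
  rw [add_add_add_comm]
  refine add_le_add ?_ ?_
  · rw [← mul_add, ← Finset.sum_add_distrib]
    refine mul_le_mul_of_nonneg_left (Finset.sum_le_sum fun w _ => fractalEnergy_add_le
      fun p p' => ?_) (inv_nonneg.2 (hR.prod_pos n).le)
    exact h _ (hK.wordMap_mem _ (hK.vertex_mem hα₀ hα₁ p)) _
      (hK.wordMap_mem _ (hK.vertex_mem hα₀ hα₁ p'))
  · rw [← Finset.sum_add_distrib]
    refine Finset.sum_le_sum fun k _ => ?_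
    rw [← mul_add, ← Finset.sum_add_distrib]
    refine mul_le_mul_of_nonneg_left (Finset.sum_le_sum fun w _ => ?_)
      (inv_nonneg.2 (hR.prod_pos k).le)
    simp only [lineEnergy]
    rw [← Finset.sum_add_distrib]
    refine Finset.sum_le_sum fun l _ => ?_
    rw [← mul_add]
    exact mul_le_mul_of_nonneg_left (hd _ l) (inv_nonneg.2 ((hR.harmonic k).rho_pos l).le)

/-! ### Oscillation estimates -/

theorem IsHarmonicStructure.exists_abs_sub_vertex_le {lam : ℝ} {ρ : S.LineIndex → ℝ}
    (h : T.IsHarmonicStructure α r₀ lam ρ) : ∃ C, 0 ≤ C ∧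
      ∀ (f : EuclideanSpace ℝ (Fin d) → ℝ) (p p' : S.postCritical),
        |f (T.vertex α p) - f (T.vertex α p')| ≤ C * √(T.fractalEnergy α r₀ f) := by
  -- The `2` compensates the factor `1/2` in the energy, as only one of the two ordered pairs is
  -- kept.
  have hedge : ∀ a b, a ≠ b → r₀ a b < ⊤ → ∀ f : EuclideanSpace ℝ (Fin d) → ℝ,
      |f (T.vertex α a) - f (T.vertex α b)| ≤
        √(2 / ((r₀ a b)⁻¹).toReal) * √(T.fractalEnergy α r₀ f) := by
    intro a b hab hlt f
    have hpos : 0 < ((r₀ a b)⁻¹).toReal :=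
      ENNReal.toReal_pos (ENNReal.inv_ne_zero.2 hlt.ne)
        (ENNReal.inv_ne_top.2 (h.resistance_pos a b hab).ne')
    rw [← Real.sqrt_mul (by positivity)]
    refine Real.abs_le_sqrt ?_
    rw [div_mul_eq_mul_div, le_div_iff₀ hpos, mul_comm]
    have h1 := Finset.single_le_sum (f := fun p' => ((r₀ a p')⁻¹).toReal *
      (f (T.vertex α a) - f (T.vertex α p')) ^ 2) (fun _ _ => by positivity) (Finset.mem_univ b)
    have h2 := Finset.single_le_sum (f := fun p => ∑ p', ((r₀ p p')⁻¹).toReal *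
      (f (T.vertex α p) - f (T.vertex α p')) ^ 2) (fun _ _ => by positivity) (Finset.mem_univ a)
    rw [fractalEnergy]
    linarith
  have hpath : ∀ a b, ∃ C, 0 ≤ C ∧ ∀ f : EuclideanSpace ℝ (Fin d) → ℝ,
      |f (T.vertex α a) - f (T.vertex α b)| ≤ C * √(T.fractalEnergy α r₀ f) := by
    intro a b
    induction h.connected a b with
    | refl => exact ⟨0, le_rfl, fun f => by simp⟩
    | @tail b c _ hbc ih =>
      obtain ⟨C, hC, H⟩ := ih
      refine ⟨C + √(2 / ((r₀ b c)⁻¹).toReal), by positivity, fun f => ?_⟩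
      rw [add_mul]
      exact (abs_sub_le _ _ _).trans (add_le_add (H f) (hedge b c hbc.1 hbc.2 f))
  choose C hC H using hpath
  -- The sum of all path constants bounds each of them, so one constant serves all pairs.
  refine ⟨∑ a, ∑ b, C a b, Finset.sum_nonneg fun a _ => Finset.sum_nonneg fun b _ => hC a b,
    fun f p p' => (H p p' f).trans ?_⟩
  refine mul_le_mul_of_nonneg_right ?_ (Real.sqrt_nonneg _)
  exact (Finset.single_le_sum (fun b _ => hC p b) (Finset.mem_univ p')).trans
    (Finset.single_le_sum (f := fun a => ∑ b, C a b)
      (fun a _ => Finset.sum_nonneg fun b _ => hC a b) (Finset.mem_univ p))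

/-- Selects the base point `q_k`. Without post critical points there are no connecting lines, and
any letter will do. -/
theorem _root_.StretchableSet.exists_base (S : StretchableSet d N) :
    ∃ k, S.postCritical.Nonempty → S.fixedPt k ∈ S.postCritical := by
  by_cases hP : S.postCritical.Nonempty
  · obtain ⟨p, hp⟩ := hP
    obtain ⟨w, k, hk, -⟩ := S.postCritical_eq p hp
    exact ⟨k, fun _ => hk⟩
  · obtain ⟨x, hx⟩ := S.isConnected_carrier.nonempty
    rw [S.carrier_eq] at hx
    obtain ⟨i, -⟩ := Set.mem_iUnion.1 hx
    exact ⟨i, fun h => absurd h hP⟩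

/-- The oscillation over the first level is controlled by the energies of the 1-cells and of the
connecting lines. -/
theorem IsRegularSequence.exists_abs_sub_le_cell (hR : T.IsRegularSequence α r₀ lam ρ) {k : Fin N}
    (hk : S.postCritical.Nonempty → S.fixedPt k ∈ S.postCritical) {R : ℝ} :
    ∃ C, 0 ≤ C ∧ ∀ (f : EuclideanSpace ℝ (Fin d) → ℝ) (e : ℝ), 0 ≤ e →
      (∀ i, T.fractalEnergy α r₀ (f ∘ S.stretch α i) ≤ e) →
      (∀ l, MemH1 (f ∘ T.linePath α l) ∧ dirichletEnergy (f ∘ T.linePath α l) ≤ R * e) →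
      (∀ i, |f (S.stretch α i (S.fixedPt k)) - f (S.fixedPt k)| ≤ C * √e) ∧
      ∀ l, ∀ t ∈ Set.Icc (0 : ℝ) 1, |f (T.linePath α l t) - f (S.fixedPt k)| ≤ C * √e := by
  -- The inequality involves only the common `r₀`, so any index gives a constant valid at all
  -- levels.
  obtain ⟨B, hB, hvertex⟩ := (hR.harmonic 0).exists_abs_sub_vertex_le
  have hcell : ∀ (f : EuclideanSpace ℝ (Fin d) → ℝ) (e : ℝ),
      (∀ i, T.fractalEnergy α r₀ (f ∘ S.stretch α i) ≤ e) → ∀ i p p',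
      |f (S.stretch α i (T.vertex α p)) - f (S.stretch α i (T.vertex α p'))| ≤ B * √e := by
    intro f e he i p p'
    exact (hvertex (f ∘ S.stretch α i) p p').trans
      (mul_le_mul_of_nonneg_left (Real.sqrt_le_sqrt (he i)) hB)
  have hline : ∀ (f : EuclideanSpace ℝ (Fin d) → ℝ) (e : ℝ), 0 ≤ e →
      (∀ l, MemH1 (f ∘ T.linePath α l) ∧ dirichletEnergy (f ∘ T.linePath α l) ≤ R * e) →
      ∀ l, ∀ s ∈ Set.Icc (0 : ℝ) 1, ∀ t ∈ Set.Icc (0 : ℝ) 1,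
      |f (T.linePath α l t) - f (T.linePath α l s)| ≤ √R * √e := by
    intro f e he hf l s hs t ht
    rw [← Real.sqrt_mul' _ he]
    refine Real.abs_le_sqrt (((hf l).1.sq_sub_le hs ht).trans ?_)
    refine le_trans (mul_le_of_le_one_left (dirichletEnergy_nonneg _) ?_) (hf l).2
    rw [abs_le]
    constructor <;> linarith [hs.1, hs.2, ht.1, ht.2]
  -- From a point on a line go to its end, a vertex of the 1-cell, and from there within that cell
  -- to the image of `q_k`.
  have hend : ∀ (f : EuclideanSpace ℝ (Fin d) → ℝ) (e : ℝ), 0 ≤ e →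
      (∀ i, T.fractalEnergy α r₀ (f ∘ S.stretch α i) ≤ e) →
      (∀ l, MemH1 (f ∘ T.linePath α l) ∧ dirichletEnergy (f ∘ T.linePath α l) ≤ R * e) →
      ∀ l, ∀ t ∈ Set.Icc (0 : ℝ) 1,
      |f (T.linePath α l t) - f (S.stretch α l.1.1 (S.fixedPt k))| ≤ (√R + B) * √e := by
    intro f e he hf hl l t ht
    have hkP := hk ⟨l.1.2, l.1.2.2⟩
    have h1 := hline f e he hl l 1 (by simp) t ht
    have h2 := hcell f e hf l.1.1 l.1.2 ⟨S.fixedPt k, hkP⟩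
    rw [T.vertex_fixedPt, ← T.lineEnd_eq, ← T.linePath_one] at h2
    rw [add_mul]
    exact (abs_sub_le _ _ _).trans (add_le_add h1 h2)
  have hpath : ∀ i, ∃ C, 0 ≤ C ∧ ∀ (f : EuclideanSpace ℝ (Fin d) → ℝ) (e : ℝ), 0 ≤ e →
      (∀ i, T.fractalEnergy α r₀ (f ∘ S.stretch α i) ≤ e) →
      (∀ l, MemH1 (f ∘ T.linePath α l) ∧ dirichletEnergy (f ∘ T.linePath α l) ≤ R * e) →
      |f (S.stretch α i (S.fixedPt k)) - f (S.fixedPt k)| ≤ C * √e := by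
    intro i
    induction S.reflTransGen_cells k i with
    | refl => exact ⟨0, le_rfl, fun f e _ _ _ => by simp [S.stretch_fixedPt]⟩
    | @tail i j _ hij ih =>
      obtain ⟨C, hC, H⟩ := ih
      -- Neighbouring cells are joined through the critical point where the two lines start.
      obtain ⟨l, l', rfl, rfl, hll⟩ := S.exists_lineIndex hij.1 hij.2
      refine ⟨(√R + B) + (√R + B) + C, by positivity, fun f e he hf hl => ?_⟩
      have h1 := hend f e he hf hl l 0 (by simp)
      have h2 := hend f e he hf hl l' 0 (by simp)
      rw [T.linePath_zero] at h1 h2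
      rw [hll] at h1
      rw [abs_sub_comm] at h2
      rw [add_mul, add_mul]
      exact (abs_sub_le _ _ _).trans (add_le_add ((abs_sub_le _ _ _).trans (add_le_add h2 h1))
        (H f e he hf hl))
  choose C hC H using hpath
  have hsum : ∀ i, C i ≤ ∑ i, C i := fun i =>
    Finset.single_le_sum (fun i _ => hC i) (Finset.mem_univ i)
  have hnn : 0 ≤ √R + B := by positivity
  have hnn' : 0 ≤ ∑ i, C i := Finset.sum_nonneg fun i _ => hC i
  refine ⟨√R + B + ∑ i, C i, by positivity, fun f e he hf hl => ⟨fun i => ?_, fun l t ht => ?_⟩⟩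
  · refine (H i f e he hf hl).trans (mul_le_mul_of_nonneg_right ?_ (Real.sqrt_nonneg _))
    linarith [hsum i]
  · rw [add_mul]
    refine (abs_sub_le _ _ _).trans (add_le_add (hend f e he hf hl l t ht)
      ((H _ f e he hf hl).trans (mul_le_mul_of_nonneg_right (hsum _) (Real.sqrt_nonneg _))))

theorem IsRegularSequence.prod_add_le (hR : T.IsRegularSequence α r₀ lam ρ) {L : ℝ}
    (hL : ∀ k, lam k ≤ L) (n j : ℕ) :
    ∏ i ∈ Finset.range (n + j), lam i ≤ L ^ j * ∏ i ∈ Finset.range n, lam i := by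
  induction j with
  | zero => simp
  | succ j ih =>
    rw [← add_assoc, Finset.prod_range_succ, pow_succ, mul_right_comm]
    exact mul_le_mul ih (hL _) (hR.harmonic _).lam_pos.le
      ((hR.prod_pos _).le.trans ih)

/-- The oscillation on a cell is controlled by the energy and the scaling factor of its level. -/
theorem IsRegularSequence.exists_abs_sub_le (hR : T.IsRegularSequence α r₀ lam ρ)
    (hα₀ : 0 ≤ α) (hα₁ : α < 1) (hK : T.IsStretchedFractal α K) :
    ∃ q ∈ K, ∃ M, 0 ≤ M ∧ ∀ (f : EuclideanSpace ℝ (Fin d) → ℝ) (e : ℝ), ContinuousOn f K →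
      T.LinewiseH1 α f → (∀ n, T.levelEnergy α r₀ lam ρ n f ≤ e) → ∀ (v : List (Fin N)), ∀ x ∈ K,
      |f (wordMap (S.stretch α) v x) - f (wordMap (S.stretch α) v q)| ≤
        M * √((∏ j ∈ Finset.range v.length, lam j) * e) := by
  obtain ⟨k, hk⟩ := S.exists_base
  obtain ⟨L, hL₁, hL⟩ := hR.lam_le
  obtain ⟨R, hRho⟩ := hR.rho_le
  obtain ⟨C, hC, hstep⟩ := hR.exists_abs_sub_le_cell hk (R := R)
  have hqK := hK.fixedPt_mem hα₀ hα₁ k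
  set q := S.fixedPt k with hq
  have hL₀ : 0 ≤ L := (hR.harmonic 0).lam_pos.le.trans (hL 0)
  have hθ : √L < 1 := by rw [Real.sqrt_lt' one_pos]; simpa using hL₁
  have hθ0 : 0 < 1 - √L := by linarith
  -- `M` is the sum of the geometric series of the one-step bounds `C √L ^ j`.
  refine ⟨q, hqK, C / (1 - √L), by positivity, fun f e hcont hf he v x hx => ?_⟩
  have he0 : 0 ≤ e := (hR.levelEnergy_nonneg 0 f).trans (he 0)
  set D := √((∏ j ∈ Finset.range v.length, lam j) * e) with hD
  have hpow : ∀ j : ℕ, √L ^ j = √(L ^ j) := fun j => by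
    rw [← Real.sqrt_sq (pow_nonneg (Real.sqrt_nonneg L) j), ← pow_mul, mul_comm, pow_mul,
      Real.sq_sqrt hL₀]
  -- The one-level estimate in the cell of `v ++ w`, whose scaling factor is at most `L ^ w.length`
  -- times that of `v`.
  have hcell : ∀ w : List (Fin N),
      (∀ i, |f (wordMap (S.stretch α) (v ++ w) (S.stretch α i q)) -
        f (wordMap (S.stretch α) (v ++ w) q)| ≤ C * (√L ^ w.length * D)) ∧
      ∀ l, ∀ t ∈ Set.Icc (0 : ℝ) 1, |f (wordMap (S.stretch α) (v ++ w) (T.linePath α l t)) -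
        f (wordMap (S.stretch α) (v ++ w) q)| ≤ C * (√L ^ w.length * D) := by
    intro w
    have hpos := (hR.prod_pos (v ++ w).length).le
    have hη : √((∏ j ∈ Finset.range (v ++ w).length, lam j) * e) ≤ √L ^ w.length * D := by
      rw [hD, hpow, ← Real.sqrt_mul (pow_nonneg hL₀ _), List.length_append,
        ← mul_assoc]
      exact Real.sqrt_le_sqrt (mul_le_mul_of_nonneg_right (hR.prod_add_le hL _ _) he0)
    have hfr : ∀ i, T.fractalEnergy α r₀ ((f ∘ wordMap (S.stretch α) (v ++ w)) ∘ S.stretch α i) ≤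
        (∏ j ∈ Finset.range (v ++ w).length, lam j) * e := by
      intro i
      have h1 := hR.fractalEnergy_cell_le ((v ++ w) ++ [i]) f
      rw [wordMap_append, wordMap_singleton, ← Function.comp_assoc] at h1
      refine h1.trans ?_
      rw [List.length_append (bs := [i]), List.length_singleton, Finset.prod_range_succ]
      exact mul_le_mul (mul_le_of_le_one_right hpos (hR.harmonic _).lam_lt_one.le) (he _)
        (hR.levelEnergy_nonneg _ f) hpos
    have hln : ∀ l, dirichletEnergy ((f ∘ wordMap (S.stretch α) (v ++ w)) ∘ T.linePath α l) ≤
        R * ((∏ j ∈ Finset.range (v ++ w).length, lam j) * e) := by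
      intro l
      refine (hR.dirichletEnergy_line_le (v ++ w) l f).trans ?_
      refine mul_le_mul (hRho _ _) (mul_le_mul_of_nonneg_left (he _) hpos)
        (mul_nonneg hpos (hR.levelEnergy_nonneg _ f)) ?_
      exact ((hR.harmonic 0).rho_pos l).le.trans (hRho _ _)
    obtain ⟨h1, h2⟩ := hstep _ _ (mul_nonneg hpos he0) hfr fun l => ⟨hf _ l, hln l⟩
    exact ⟨fun i => (h1 i).trans (mul_le_mul_of_nonneg_left hη hC),
      fun l t ht => (h2 l t ht).trans (mul_le_mul_of_nonneg_left hη hC)⟩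
  have hgeom : ∀ m, ∑ j ∈ Finset.range m, C * (√L ^ j * D) ≤ C / (1 - √L) * D := by
    intro m
    rw [← Finset.mul_sum, ← Finset.sum_mul, div_eq_mul_inv, mul_assoc]
    refine mul_le_mul_of_nonneg_left (mul_le_mul_of_nonneg_right ?_ (Real.sqrt_nonneg _)) hC
    rw [← tsum_geometric_of_lt_one (Real.sqrt_nonneg L) hθ]
    exact (summable_geometric_of_lt_one (Real.sqrt_nonneg L) hθ).sum_le_tsum _
      (fun _ _ => by positivity)
  -- If the bound fails at `x`, then `x` cannot be met on a line after finitely many steps, since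
  -- the partial sum would already prove the bound. So `x` lies in nested cells of all levels, with
  -- base points controlled by the partial sums.
  by_contra! hbad
  have hall : ∀ m, ∃ w : List (Fin N), w.length = m ∧ (∃ y ∈ K, wordMap (S.stretch α) w y = x) ∧
      |f (wordMap (S.stretch α) (v ++ w) q) - f (wordMap (S.stretch α) v q)| ≤
        ∑ j ∈ Finset.range m, C * (√L ^ j * D) := by
    intro m
    induction m with
    | zero => exact ⟨[], rfl, ⟨x, hx, rfl⟩, by simp⟩
    | succ m ih =>
      obtain ⟨w, hw, ⟨y, hy, hyx⟩, hle⟩ := ih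
      rw [hK.2.2] at hy
      rcases hy with hy | hy
      · obtain ⟨i, z, hz, rfl⟩ := Set.mem_iUnion.1 hy
        refine ⟨w ++ [i], by simp [hw], ⟨z, hz, by rw [wordMap_append]; exact hyx⟩, ?_⟩
        rw [← List.append_assoc, wordMap_append, Finset.sum_range_succ, add_comm, ← hw]
        exact (abs_sub_le _ _ _).trans (add_le_add ((hcell w).1 i) (hw ▸ hle))
      · obtain ⟨l, t, ht, rfl⟩ := Set.mem_iUnion.1 hy
        refine absurd ?_ (not_le.2 hbad)
        refine le_trans ?_ (hgeom (m + 1))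
        have h2 := (hcell w).2 l t ht
        rw [wordMap_append, Function.comp_apply, hyx] at h2
        rw [Finset.sum_range_succ, add_comm, ← hw]
        refine (abs_sub_le _ _ _).trans (add_le_add h2 ?_)
        rw [← Function.comp_apply (f := wordMap (S.stretch α) v), ← wordMap_append]
        exact hw ▸ hle
  choose w hw hwx hle using hall
  choose y hy hyx using hwx
  obtain ⟨B, hB⟩ := hK.1.isBounded.exists_norm_le
  -- The nested cells shrink to `x`, so their base points converge to it and continuity of `f` gives
  -- the bound at `x`, contradicting `hbad`.
  have hlim : Tendsto (fun m => wordMap (S.stretch α) (v ++ w m) q) atTop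
      (𝓝[K] (wordMap (S.stretch α) v x)) := by
    refine tendsto_nhdsWithin_iff.2 ⟨?_, Eventually.of_forall fun m => hK.wordMap_mem _ hqK⟩
    have h1 : Tendsto (fun m => wordMap (S.stretch α) (w m) q) atTop (𝓝 x) := by
      rw [tendsto_iff_dist_tendsto_zero]
      refine squeeze_zero (g := fun m => α ^ m * (B + B)) (fun _ => dist_nonneg) (fun m => ?_) ?_
      · conv_lhs => rw [← hyx m]
        refine (S.dist_wordMap_stretch_le hα₀ _ _ _).trans ?_
        rw [hw]
        refine mul_le_mul_of_nonneg_left ?_ (pow_nonneg hα₀ _)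
        exact (dist_le_norm_add_norm _ _).trans (add_le_add (hB _ hqK) (hB _ (hy m)))
      · simpa using (tendsto_pow_atTop_nhds_zero_of_lt_one hα₀ hα₁).mul_const (B + B)
    have h2 := ((S.continuous_wordMap_stretch hα₀ v).tendsto x).comp h1
    simpa only [wordMap_append, Function.comp_def] using h2
  have hlim' := ((hcont _ (hK.wordMap_mem v hx)).tendsto.comp hlim).sub_const
    (f (wordMap (S.stretch α) v q))
  exact hbad.not_ge (le_of_tendsto hlim'.abs
    (Eventually.of_forall fun m => (hle m).trans (hgeom m)))

end StretchableSet.Addressing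

/-! ### Extension by zero -/

section ExtendZero

variable {X : Type*} {K : Set X}

theorem extendZero_coe (u : K → ℝ) (x : K) : extendZero u x = u x :=
  Subtype.val_injective.extend_apply u 0 x

theorem extendZero_of_mem (u : K → ℝ) {x : X} (hx : x ∈ K) : extendZero u x = u ⟨x, hx⟩ :=
  extendZero_coe u ⟨x, hx⟩

theorem extendZero_of_notMem (u : K → ℝ) {x : X} (hx : x ∉ K) : extendZero u x = 0 :=
  Function.extend_apply' _ _ _ (by rintro ⟨y, rfl⟩; exact hx y.2)

theorem extendZero_add (u v : K → ℝ) : extendZero (u + v) = extendZero u + extendZero v := by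
  funext x
  by_cases hx : x ∈ K
  · simp [extendZero_of_mem _ hx]
  · simp [extendZero_of_notMem _ hx]

theorem extendZero_smul (c : ℝ) (u : K → ℝ) : extendZero (c • u) = c • extendZero u := by
  funext x
  by_cases hx : x ∈ K
  · simp [extendZero_of_mem _ hx]
  · simp [extendZero_of_notMem _ hx]

theorem extendZero_sub (u v : K → ℝ) : extendZero (u - v) = extendZero u - extendZero v := by
  funext x
  by_cases hx : x ∈ K
  · simp [extendZero_of_mem _ hx]
  · simp [extendZero_of_notMem _ hx]

theorem continuousOn_extendZero [TopologicalSpace X] {u : K → ℝ} (hu : Continuous u) :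
    ContinuousOn (extendZero u) K := by
  rw [continuousOn_iff_continuous_domRestrict]
  convert hu using 1
  funext x
  exact extendZero_coe u x

end ExtendZero

/-! ### Locally constant functions near a totally disconnected compact set -/

/-- If `x ∉ A`, the closed sets `{x}` and `A` are disjoint, and a preconnected subset of their union
lies in one of them. -/
theorem IsTotallyDisconnected.insert_point {X : Type*} [TopologicalSpace X] [T1Space X] {A : Set X}
    (hA : IsTotallyDisconnected A) (hc : IsClosed A) (x : X) :
    IsTotallyDisconnected (insert x A) := by
  intro t ht htc
  by_cases hx : x ∈ A
  · exact hA t (by rwa [Set.insert_eq_of_mem hx] at ht) htc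
  have h := isPreconnected_iff_subset_of_disjoint_closed.1 htc {x} A isClosed_singleton hc
    (by rwa [Set.insert_eq] at ht) (by
      rw [Set.singleton_inter_eq_empty.2 hx, Set.inter_empty])
  rcases h with h | h
  · exact Set.subsingleton_singleton.anti h
  · exact hA t h htc

/-- A Lipschitz function which separates two given points and is locally constant around a totally
disconnected compact set. -/
theorem IsTotallyDisconnected.exists_lipschitzWith {X : Type*} [MetricSpace X] {A : Set X}
    (hA : IsTotallyDisconnected A) (hc : IsCompact A) {x y : X} (hxy : x ≠ y) :
    ∃ φ : X → ℝ, LipschitzWith 1 φ ∧ φ x ≠ φ y ∧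
      ∃ δ > 0, ∀ a ∈ A, ∀ z, dist z a < δ → φ z = φ a := by
  -- With `x` and `y` adjoined, one clopen splitting separates them whether or not they lie in `A`.
  set B := insert x (insert y A) with hB
  have hBc : IsCompact B := (hc.insert y).insert x
  have hBd : IsTotallyDisconnected B := (hA.insert_point hc.isClosed y).insert_point (hc.insert y).isClosed x
  have : CompactSpace B := isCompact_iff_compactSpace.1 hBc
  have : TotallyDisconnectedSpace B := totallyDisconnectedSpace_subtype_iff.2 hBd
  have hxB : x ∈ B := Set.mem_insert _ _
  have hyB : y ∈ B := Set.mem_insert_of_mem _ (Set.mem_insert _ _)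
  obtain ⟨U, hU, hxU, hyU⟩ := exists_isClopen_of_totally_separated
    (show (⟨x, hxB⟩ : B) ≠ ⟨y, hyB⟩ from fun h => hxy (congrArg Subtype.val h))
  set B₁ : Set X := Subtype.val '' U with hB₁
  set B₂ : Set X := Subtype.val '' Uᶜ with hB₂
  have hB₁c : IsCompact B₁ := hU.1.isCompact.image continuous_subtype_val
  have hB₂c : IsCompact B₂ := hU.compl.1.isCompact.image continuous_subtype_val
  have hdisj : Disjoint B₁ B₂ :=
    (Set.disjoint_image_iff Subtype.val_injective).2 disjoint_compl_right
  obtain ⟨ε, hε, hth⟩ := hdisj.exists_thickenings hB₁c hB₂c.isClosed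
  have hx₁ : x ∈ B₁ := ⟨_, hxU, rfl⟩
  have hy₂ : y ∈ B₂ := ⟨_, hyU, rfl⟩
  have hfar : ∀ b ∈ B₂, ε ≤ Metric.infDist b B₁ := by
    intro b hb
    by_contra! hlt
    refine Set.disjoint_left.1 hth ?_ (Metric.self_subset_thickening hε _ hb)
    exact (Metric.mem_thickening_iff_infDist_lt ⟨x, hx₁⟩).2 hlt
  -- The distance to `B₁` is truncated at `ε/3` and `2ε/3`; as `B₂` is at distance at least `ε`,
  -- this is flat within `ε/3` of either set.
  let φ : X → ℝ := fun z => max (ε / 3) (min (2 * ε / 3) (Metric.infDist z B₁))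
  have hφ₁ : ∀ b ∈ B₁, ∀ z, dist z b < ε / 3 → φ z = ε / 3 := by
    intro b hb z hz
    have := (Metric.infDist_le_dist_of_mem (x := z) hb).trans hz.le
    exact max_eq_left ((min_le_right _ _).trans this)
  have hφ₂ : ∀ b ∈ B₂, ∀ z, dist z b < ε / 3 → φ z = 2 * ε / 3 := by
    intro b hb z hz
    have h1 := hfar b hb
    have h2 := Metric.infDist_le_infDist_add_dist (s := B₁) (x := b) (y := z)
    rw [dist_comm] at h2
    have h3 : min (2 * ε / 3) (Metric.infDist z B₁) = 2 * ε / 3 := min_eq_left (by linarith)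
    simp only [φ, h3]
    exact max_eq_right (by linarith)
  have hself : ∀ z : X, dist z z < ε / 3 := fun z => by rw [dist_self]; positivity
  refine ⟨φ, ?_, ?_, ε / 3, by positivity, fun a ha z hz => ?_⟩
  · exact ((Metric.lipschitz_infDist_pt B₁).const_min _).const_max _
  · rw [hφ₁ x hx₁ x (hself x), hφ₂ y hy₂ y (hself y)]
    intro h
    linarith
  · have haB : a ∈ B := Set.mem_insert_of_mem _ (Set.mem_insert_of_mem _ ha)
    by_cases haU : (⟨a, haB⟩ : B) ∈ U
    · have h1 : a ∈ B₁ := ⟨_, haU, rfl⟩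
      rw [hφ₁ a h1 z hz, hφ₁ a h1 a (hself a)]
    · have h1 : a ∈ B₂ := ⟨_, haU, rfl⟩
      rw [hφ₂ a h1 z hz, hφ₂ a h1 a (hself a)]

namespace StretchableSet.Addressing

variable {d N : ℕ} {S : StretchableSet d N} {T : S.Addressing} {α : ℝ}
  {K : Set (EuclideanSpace ℝ (Fin d))} {r₀ : S.postCritical → S.postCritical → ENNReal}
  {lam : ℕ → ℝ} {ρ : ℕ → S.LineIndex → ℝ}

/-! ### The level energies as quadratic forms -/

/-- The continuous functions on `K` that are in `H^1` along all connecting lines. -/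
def linewiseSpace (T : S.Addressing) (α : ℝ) (K : Set (EuclideanSpace ℝ (Fin d))) :
    Submodule ℝ (K → ℝ) where
  carrier := {u | Continuous u ∧ T.LinewiseH1 α (extendZero u)}
  add_mem' hu hv := ⟨hu.1.add hv.1, fun w l => by
    rw [extendZero_add]
    exact sobolevH1.add_mem (hu.2 w l) (hv.2 w l)⟩
  zero_mem' := ⟨continuous_zero, fun w l => by
    have h : extendZero (0 : K → ℝ) = 0 := by simpa using extendZero_smul 0 (0 : K → ℝ)
    rw [h]
    exact sobolevH1.zero_mem⟩
  smul_mem' c u hu := ⟨hu.1.const_smul c, fun w l => by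
    rw [extendZero_smul]
    exact sobolevH1.smul_mem c (hu.2 w l)⟩

/-- The difference of the values at two points. -/
noncomputable def valueSub (T : S.Addressing) (α : ℝ) (K : Set (EuclideanSpace ℝ (Fin d)))
    (x y : EuclideanSpace ℝ (Fin d)) : linewiseSpace T α K →ₗ[ℝ] ℝ where
  toFun u := extendZero (u : K → ℝ) x - extendZero (u : K → ℝ) y
  map_add' u v := by
    simp only [Submodule.coe_add, extendZero_add, Pi.add_apply]
    ring
  map_smul' c u := by
    simp only [Submodule.coe_smul, extendZero_smul, Pi.smul_apply, smul_eq_mul, RingHom.id_apply]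
    ring

/-- The restriction to a connecting line. -/
noncomputable def restrictLine (T : S.Addressing) (α : ℝ) (K : Set (EuclideanSpace ℝ (Fin d)))
    (w : List (Fin N)) (l : S.LineIndex) : linewiseSpace T α K →ₗ[ℝ] sobolevH1 where
  toFun u := ⟨extendZero (u : K → ℝ) ∘ wordMap (S.stretch α) w ∘ T.linePath α l, u.2.2 w l⟩
  map_add' u v := Subtype.ext (by simp only [Submodule.coe_add, extendZero_add]; rfl)
  map_smul' c u := Subtype.ext (by
    simp only [Submodule.coe_smul, extendZero_smul, RingHom.id_apply]; rfl)

/-- `E_{R,n}` as a quadratic form. -/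
noncomputable def levelForm (T : S.Addressing) (α : ℝ)
    (r₀ : S.postCritical → S.postCritical → ENNReal) (lam : ℕ → ℝ) (ρ : ℕ → S.LineIndex → ℝ)
    (K : Set (EuclideanSpace ℝ (Fin d))) (n : ℕ) : QuadraticForm ℝ (linewiseSpace T α K) :=
  (∏ j ∈ Finset.range n, lam j)⁻¹ • ∑ w : Fin n → Fin N, (1 / 2 : ℝ) • ∑ p, ∑ p',
      ((r₀ p p')⁻¹).toReal • QuadraticMap.sq.comp
        (T.valueSub α K (wordMap (S.stretch α) (List.ofFn w) (T.vertex α p))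
          (wordMap (S.stretch α) (List.ofFn w) (T.vertex α p'))) +
    ∑ k ∈ Finset.range n, (∏ j ∈ Finset.range k, lam j)⁻¹ • ∑ w : Fin k → Fin N,
      ∑ l, (ρ k l)⁻¹ • dirichletForm.comp (T.restrictLine α K (List.ofFn w) l)

theorem levelForm_apply (n : ℕ) (u : linewiseSpace T α K) :
    levelForm T α r₀ lam ρ K n u = T.levelEnergy α r₀ lam ρ n (extendZero (u : K → ℝ)) := by
  simp only [levelForm, levelEnergy, fractalEnergy, lineEnergy, add_apply,
    sum_apply, smul_apply, QuadraticMap.comp_apply, dirichletForm_apply,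
    QuadraticMap.sq_apply, smul_eq_mul, ← sq]
  rfl

/-- The level energies are monotone, so convergence is the same as boundedness. -/
theorem IsRegularSequence.mem_limitDomain_iff (hR : T.IsRegularSequence α r₀ lam ρ) {u : K → ℝ} :
    u ∈ T.limitDomain α r₀ lam ρ K ↔ u ∈ linewiseSpace T α K ∧
      ∃ C, ∀ n, T.levelEnergy α r₀ lam ρ n (extendZero u) ≤ C := by
  constructor
  · rintro ⟨h1, h2, e, he⟩
    exact ⟨⟨h1, h2⟩, e, fun n => (hR.levelEnergy_mono h2).ge_of_tendsto he n⟩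
  · rintro ⟨⟨h1, h2⟩, C, hC⟩
    exact ⟨h1, h2, _, tendsto_atTop_ciSup (hR.levelEnergy_mono h2)
      ⟨C, by rintro _ ⟨n, rfl⟩; exact hC n⟩⟩

theorem tendsto_levelEnergy {u : K → ℝ} (hu : u ∈ T.limitDomain α r₀ lam ρ K) :
    Tendsto (fun n => T.levelEnergy α r₀ lam ρ n (extendZero u)) atTop
      (𝓝 (T.limitEnergy α r₀ lam ρ K u)) :=
  tendsto_nhds_limUnder hu.2.2

theorem IsRegularSequence.levelEnergy_le (hR : T.IsRegularSequence α r₀ lam ρ) {u : K → ℝ}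
    (hu : u ∈ T.limitDomain α r₀ lam ρ K) (n : ℕ) :
    T.levelEnergy α r₀ lam ρ n (extendZero u) ≤ T.limitEnergy α r₀ lam ρ K u :=
  (hR.levelEnergy_mono hu.2.1).ge_of_tendsto (tendsto_levelEnergy hu) n

theorem IsRegularSequence.limitEnergy_nonneg (hR : T.IsRegularSequence α r₀ lam ρ) {u : K → ℝ}
    (hu : u ∈ T.limitDomain α r₀ lam ρ K) : 0 ≤ T.limitEnergy α r₀ lam ρ K u :=
  (hR.levelEnergy_nonneg 0 _).trans (hR.levelEnergy_le hu 0)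

/-- The domain of the limit form as a linear space. -/
noncomputable def limitSpace (hR : T.IsRegularSequence α r₀ lam ρ)
    (K : Set (EuclideanSpace ℝ (Fin d))) : Submodule ℝ (K → ℝ) :=
  (boundedVectors (levelForm T α r₀ lam ρ K) fun n u => by
    rw [levelForm_apply]
    exact hR.levelEnergy_nonneg n _).map (linewiseSpace T α K).subtype

theorem mem_limitSpace (hR : T.IsRegularSequence α r₀ lam ρ) {u : K → ℝ} :
    u ∈ limitSpace hR K ↔ u ∈ T.limitDomain α r₀ lam ρ K := by
  rw [hR.mem_limitDomain_iff]
  constructor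
  · rintro ⟨v, ⟨C, hC⟩, rfl⟩
    exact ⟨v.2, C, fun n => (levelForm_apply n v).symm.trans_le (hC n)⟩
  · rintro ⟨h, C, hC⟩
    exact ⟨⟨u, h⟩, ⟨C, fun n => by simpa only [levelForm_apply] using hC n⟩, rfl⟩

theorem IsRegularSequence.exists_limitForm (hR : T.IsRegularSequence α r₀ lam ρ) :
    ∃ Q : QuadraticForm ℝ (limitSpace hR K),
      ∀ u : limitSpace hR K, Q u = T.limitEnergy α r₀ lam ρ K u := by
  refine QuadraticMap.exists_of_tendsto
    (Q := fun n => (levelForm T α r₀ lam ρ K n).comp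
      (Submodule.inclusion (Submodule.map_subtype_le _ _))) fun u => ?_
  simp only [QuadraticMap.comp_apply, levelForm_apply]
  exact tendsto_levelEnergy ((mem_limitSpace hR).1 u.2)

/-! ### Contractions and constants -/

theorem IsRegularSequence.mem_of_sq_add_sq_le (hR : T.IsRegularSequence α r₀ lam ρ)
    (hα₀ : 0 ≤ α) (hα₁ : α < 1) (hK : T.IsStretchedFractal α K) {f g u : K → ℝ}
    (hu : u ∈ T.limitDomain α r₀ lam ρ K)
    (h : ∀ x y, (f x - f y) ^ 2 + (g x - g y) ^ 2 ≤ (u x - u y) ^ 2) :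
    f ∈ T.limitDomain α r₀ lam ρ K ∧ g ∈ T.limitDomain α r₀ lam ρ K ∧
      T.limitEnergy α r₀ lam ρ K f + T.limitEnergy α r₀ lam ρ K g ≤
        T.limitEnergy α r₀ lam ρ K u := by
  have hcont : ∀ f : K → ℝ, (∀ x y, (f x - f y) ^ 2 ≤ (u x - u y) ^ 2) → Continuous f := by
    intro f hf
    rw [continuous_iff_continuousAt]
    intro x
    rw [ContinuousAt, tendsto_iff_dist_tendsto_zero]
    refine squeeze_zero (fun _ => dist_nonneg) (fun y => ?_)
      (tendsto_iff_dist_tendsto_zero.1 (hu.1.tendsto x))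
    rw [Real.dist_eq, Real.dist_eq]
    exact sq_le_sq.1 (hf y x)
  have h' : ∀ x ∈ K, ∀ y ∈ K, (extendZero f x - extendZero f y) ^ 2 +
      (extendZero g x - extendZero g y) ^ 2 ≤ (extendZero u x - extendZero u y) ^ 2 := by
    intro x hx y hy
    simpa only [extendZero_of_mem _ hx, extendZero_of_mem _ hy] using h ⟨x, hx⟩ ⟨y, hy⟩
  obtain ⟨h1, h2, -⟩ := LinewiseH1.of_sq_add_sq_le hK hu.2.1 h'
  have hle := hR.levelEnergy_add_le hα₀ hα₁ hK hu.2.1 h'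
  have hf : f ∈ T.limitDomain α r₀ lam ρ K := hR.mem_limitDomain_iff.2
    ⟨⟨hcont f fun x y => by nlinarith [h x y, sq_nonneg (g x - g y)], h1⟩, _, fun n =>
      ((le_add_of_nonneg_right (hR.levelEnergy_nonneg n _)).trans (hle n)).trans
        (hR.levelEnergy_le hu n)⟩
  have hg : g ∈ T.limitDomain α r₀ lam ρ K := hR.mem_limitDomain_iff.2
    ⟨⟨hcont g fun x y => by nlinarith [h x y, sq_nonneg (f x - f y)], h2⟩, _, fun n =>
      ((le_add_of_nonneg_left (hR.levelEnergy_nonneg n _)).trans (hle n)).trans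
        (hR.levelEnergy_le hu n)⟩
  exact ⟨hf, hg, le_of_tendsto_of_tendsto' ((tendsto_levelEnergy hf).add (tendsto_levelEnergy hg))
    (tendsto_levelEnergy hu) hle⟩

theorem IsRegularSequence.contraction (hR : T.IsRegularSequence α r₀ lam ρ)
    (hα₀ : 0 ≤ α) (hα₁ : α < 1) (hK : T.IsStretchedFractal α K) {f u : K → ℝ}
    (hu : u ∈ T.limitDomain α r₀ lam ρ K)
    (h : ∀ x y, (f x - f y) ^ 2 ≤ (u x - u y) ^ 2) :
    f ∈ T.limitDomain α r₀ lam ρ K ∧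
      T.limitEnergy α r₀ lam ρ K f ≤ T.limitEnergy α r₀ lam ρ K u := by
  obtain ⟨h1, h2, h3⟩ := hR.mem_of_sq_add_sq_le hα₀ hα₁ hK (f := f) (g := fun _ => 0) hu
    (fun x y => by simpa using h x y)
  exact ⟨h1, by linarith [hR.limitEnergy_nonneg h2]⟩

/-- A constant is a contraction of the zero function. -/
theorem IsRegularSequence.const_mem (hR : T.IsRegularSequence α r₀ lam ρ)
    (hα₀ : 0 ≤ α) (hα₁ : α < 1) (hK : T.IsStretchedFractal α K) (a : ℝ) :
    (fun _ : K => a) ∈ T.limitDomain α r₀ lam ρ K ∧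
      T.limitEnergy α r₀ lam ρ K (fun _ => a) = 0 := by
  have h0 : (0 : K → ℝ) ∈ limitSpace hR K := Submodule.zero_mem _
  obtain ⟨Q, hQ⟩ := hR.exists_limitForm (K := K)
  have hE : T.limitEnergy α r₀ lam ρ K 0 = 0 := by
    rw [← QuadraticMap.map_zero Q, hQ]
    rfl
  obtain ⟨h1, h2⟩ := hR.contraction hα₀ hα₁ hK (f := fun _ => a) ((mem_limitSpace hR).1 h0)
    fun x y => by simp
  exact ⟨h1, le_antisymm (h2.trans hE.le) (hR.limitEnergy_nonneg h1)⟩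

/-- The oscillation on a cell of a function in the domain. -/
theorem IsRegularSequence.exists_sq_sub_le (hR : T.IsRegularSequence α r₀ lam ρ)
    (hα₀ : 0 ≤ α) (hα₁ : α < 1) (hK : T.IsStretchedFractal α K) :
    ∃ M, 0 ≤ M ∧ ∀ u ∈ T.limitDomain α r₀ lam ρ K, ∀ (w : List (Fin N)) (x y : K),
      (x : EuclideanSpace ℝ (Fin d)) ∈ wordMap (S.stretch α) w '' K →
      (y : EuclideanSpace ℝ (Fin d)) ∈ wordMap (S.stretch α) w '' K →
      (u x - u y) ^ 2 ≤
        M * (∏ j ∈ Finset.range w.length, lam j) * T.limitEnergy α r₀ lam ρ K u := by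
  obtain ⟨q, hq, M, hM, h⟩ := hR.exists_abs_sub_le hα₀ hα₁ hK
  -- Both points are compared with the base point of the cell, hence the `2`.
  refine ⟨(2 * M) ^ 2, by positivity, fun u hu w x y hx hy => ?_⟩
  obtain ⟨x', hx', hxx⟩ := hx
  obtain ⟨y', hy', hyy⟩ := hy
  have key := h (extendZero u) _ (continuousOn_extendZero hu.1) hu.2.1 (hR.levelEnergy_le hu) w
  have h1 := key x' hx'
  have h2 := key y' hy'
  rw [hxx, extendZero_coe] at h1
  rw [hyy, extendZero_coe, abs_sub_comm] at h2
  have h3 := (abs_sub_le _ _ _).trans (add_le_add h1 h2)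
  have hnn : 0 ≤ (∏ j ∈ Finset.range w.length, lam j) * T.limitEnergy α r₀ lam ρ K u :=
    mul_nonneg (hR.prod_pos _).le (hR.limitEnergy_nonneg hu)
  calc (u x - u y) ^ 2 = |u x - u y| ^ 2 := (sq_abs _).symm
    _ ≤ _ := pow_le_pow_left₀ (abs_nonneg _) h3 2
    _ = (2 * M) ^ 2 * √((∏ j ∈ Finset.range w.length, lam j) *
        T.limitEnergy α r₀ lam ρ K u) ^ 2 := by ring
    _ = _ := by rw [Real.sq_sqrt hnn, mul_assoc]

theorem IsRegularSequence.exists_sq_sub_le_energy (hR : T.IsRegularSequence α r₀ lam ρ)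
    (hα₀ : 0 ≤ α) (hα₁ : α < 1) (hK : T.IsStretchedFractal α K) :
    ∃ M, 0 ≤ M ∧ ∀ u ∈ T.limitDomain α r₀ lam ρ K, ∀ x y : K,
      (u x - u y) ^ 2 ≤ M * T.limitEnergy α r₀ lam ρ K u := by
  obtain ⟨M, hM, h⟩ := hR.exists_sq_sub_le hα₀ hα₁ hK
  refine ⟨M, hM, fun u hu x y => ?_⟩
  simpa using h u hu [] x y ⟨x, x.2, rfl⟩ ⟨y, y.2, rfl⟩

/-! ### Separation of points -/

theorem IsRegularSequence.separates (hR : T.IsRegularSequence α r₀ lam ρ)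
    (hα₀ : 0 ≤ α) (hα₁ : α < 1) (hK : T.IsStretchedFractal α K)
    {A : Set (EuclideanSpace ℝ (Fin d))} (hA : S.IsFractalPart α A)
    (hA_disc : IsTotallyDisconnected A) {x y : K} (hxy : x ≠ y) :
    ∃ u ∈ T.limitDomain α r₀ lam ρ K, u x ≠ u y := by
  obtain ⟨φ, hφ, hne, δ, hδ, hconst⟩ :=
    hA_disc.exists_lipschitzWith hA.1 (Subtype.coe_injective.ne hxy)
  obtain ⟨k, -⟩ := S.exists_base
  obtain ⟨B, hB⟩ := hK.1.isBounded.exists_norm_le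
  have hqK := hK.fixedPt_mem hα₀ hα₁ k
  -- From level `n₀` on, every cell lies within `δ` of its base point `G_w(q_k)`, which belongs to
  -- the fractal part; so `φ` is constant on it and contributes no energy.
  obtain ⟨n₀, hn₀⟩ : ∃ n₀, ∀ n ≥ n₀, α ^ n * (B + B) < δ := by
    have : Tendsto (fun n : ℕ => α ^ n * (B + B)) atTop (𝓝 0) := by
      simpa using (tendsto_pow_atTop_nhds_zero_of_lt_one hα₀ hα₁).mul_const (B + B)
    exact eventually_atTop.1 (this.eventually_lt_const hδ)
  have hcell : ∀ w : List (Fin N), n₀ ≤ w.length → ∀ z ∈ K,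
      φ (wordMap (S.stretch α) w z) = φ (wordMap (S.stretch α) w (S.fixedPt k)) := by
    intro w hw z hz
    refine hconst _ (hA.wordMap_mem w (hA.fixedPt_mem hα₀ hα₁ k)) _ ?_
    refine ((S.dist_wordMap_stretch_le hα₀ _ _ _).trans ?_).trans_lt (hn₀ _ hw)
    refine mul_le_mul_of_nonneg_left ?_ (pow_nonneg hα₀ _)
    exact (dist_le_norm_add_norm _ _).trans (add_le_add (hB _ hz) (hB _ hqK))
  have hφH : T.LinewiseH1 α φ := by
    intro w l
    have hw : LipschitzWith ⟨α ^ w.length, pow_nonneg hα₀ _⟩ (wordMap (S.stretch α) w) :=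
      LipschitzWith.of_dist_le_mul fun x y => S.dist_wordMap_stretch_le hα₀ w x y
    exact memH1_of_lipschitzWith (hφ.comp (hw.comp (T.lipschitzWith_linePath α l)))
  have hzero : ∀ n ≥ n₀, T.levelEnergy α r₀ lam ρ n φ = T.levelEnergy α r₀ lam ρ n₀ φ := by
    have hfr : ∀ n ≥ n₀, ∑ w : Fin n → Fin N,
        T.fractalEnergy α r₀ (φ ∘ wordMap (S.stretch α) (List.ofFn w)) = 0 := by
      intro n hn
      refine Finset.sum_eq_zero fun w _ => ?_
      have := hcell (List.ofFn w) (by simpa using hn)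
      simp [fractalEnergy, this _ (hK.vertex_mem hα₀ hα₁ _)]
    have hln : ∀ n ≥ n₀, ∑ w : Fin n → Fin N,
        T.lineEnergy α (ρ n) (φ ∘ wordMap (S.stretch α) (List.ofFn w)) = 0 := by
      intro n hn
      refine Finset.sum_eq_zero fun w _ => Finset.sum_eq_zero fun l _ => ?_
      rw [dirichletEnergy_congr (g := fun _ =>
        φ (wordMap (S.stretch α) (List.ofFn w) (S.fixedPt k))), dirichletEnergy_const, mul_zero]
      exact fun t ht => hcell (List.ofFn w) (by simpa using hn) _ (hK.linePath_mem l ht)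
    intro n hn
    rw [levelEnergy, levelEnergy, hfr n hn, hfr n₀ le_rfl, mul_zero, mul_zero]
    congr 1
    refine (Finset.sum_subset (Finset.range_mono hn) fun k _ hk => ?_).symm
    rw [hln k (by simpa using hk), mul_zero]
  -- `φ` and the zero extension of its restriction agree only on `K`; the domination lemma with
  -- second function `0` transfers the estimates.
  have hext : ∀ x ∈ K, ∀ y ∈ K, (extendZero (fun x : K => φ x) x -
      extendZero (fun x : K => φ x) y) ^ 2 + ((0 : EuclideanSpace ℝ (Fin d) → ℝ) x -
        (0 : EuclideanSpace ℝ (Fin d) → ℝ) y) ^ 2 ≤ (φ x - φ y) ^ 2 := by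
    intro x hx y hy
    simp [extendZero_of_mem _ hx, extendZero_of_mem _ hy]
  refine ⟨fun x => φ x, hR.mem_limitDomain_iff.2 ⟨⟨hφ.continuous.comp continuous_subtype_val,
    (LinewiseH1.of_sq_add_sq_le hK hφH hext).1⟩, T.levelEnergy α r₀ lam ρ n₀ φ, fun n => ?_⟩, hne⟩
  refine le_trans (le_add_of_nonneg_right (hR.levelEnergy_nonneg n 0))
    ((hR.levelEnergy_add_le hα₀ hα₁ hK hφH hext n).trans ?_)
  exact (hR.levelEnergy_mono hφH (le_max_left n n₀)).trans (hzero _ (le_max_right n n₀)).le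

/-! ### Completeness -/

/-- At a fixed level the energy is a finite sum of terms each tending to zero. -/
theorem tendsto_levelEnergy_of_tendsto (hα₀ : 0 ≤ α) (hα₁ : α < 1)
    (hK : T.IsStretchedFractal α K) {f : ℕ → EuclideanSpace ℝ (Fin d) → ℝ}
    (h : ∀ x ∈ K, Tendsto (fun n => f n x) atTop (𝓝 0))
    (hd : ∀ w l, Tendsto (fun n => dirichletEnergy
      (f n ∘ wordMap (S.stretch α) w ∘ T.linePath α l)) atTop (𝓝 0)) (m : ℕ) :
    Tendsto (fun n => T.levelEnergy α r₀ lam ρ m (f n)) atTop (𝓝 0) := by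
  have h1 : ∀ w : List (Fin N), Tendsto (fun n => T.fractalEnergy α r₀
      (f n ∘ wordMap (S.stretch α) w)) atTop (𝓝 0) := by
    intro w
    have hp : ∀ p, Tendsto (fun n => (f n ∘ wordMap (S.stretch α) w) (T.vertex α p)) atTop (𝓝 0) :=
      fun p => h _ (hK.wordMap_mem w (hK.vertex_mem hα₀ hα₁ p))
    have := (tendsto_finsetSum Finset.univ fun p _ => tendsto_finsetSum Finset.univ fun p' _ =>
      (((hp p).sub (hp p')).pow 2).const_mul ((r₀ p p')⁻¹).toReal).const_mul (1 / 2 : ℝ)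
    simpa [fractalEnergy] using this
  have h2 : ∀ (k : ℕ) (w : List (Fin N)), Tendsto (fun n => T.lineEnergy α (ρ k)
      (f n ∘ wordMap (S.stretch α) w)) atTop (𝓝 0) := by
    intro k w
    have := tendsto_finsetSum Finset.univ fun l _ => (hd w l).const_mul (ρ k l)⁻¹
    simpa [lineEnergy, Function.comp_assoc] using this
  have h3 := ((tendsto_finsetSum Finset.univ fun (w : Fin m → Fin N) _ =>
    h1 (List.ofFn w)).const_mul (∏ j ∈ Finset.range m, lam j)⁻¹).add
    (tendsto_finsetSum (Finset.range m) fun k _ =>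
      (tendsto_finsetSum Finset.univ fun (w : Fin k → Fin N) _ =>
        h2 k (List.ofFn w)).const_mul (∏ j ∈ Finset.range k, lam j)⁻¹)
  simpa [levelEnergy] using h3

theorem IsRegularSequence.complete (hR : T.IsRegularSequence α r₀ lam ρ)
    (hα₀ : 0 ≤ α) (hα₁ : α < 1) (hK : T.IsStretchedFractal α K) {u : ℕ → K → ℝ}
    (hu : ∀ n, u n ∈ T.limitDomain α r₀ lam ρ K)
    (hc : ∀ ε > 0, ∃ n₀, ∀ m ≥ n₀, ∀ n ≥ n₀, T.limitEnergy α r₀ lam ρ K (u m - u n) < ε) :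
    ∃ v ∈ T.limitDomain α r₀ lam ρ K,
      Tendsto (fun n => T.limitEnergy α r₀ lam ρ K (u n - v)) atTop (𝓝 0) := by
  -- Subtracting constants changes no energy, so all functions may vanish at a common point; the
  -- oscillation bound then turns energy-Cauchy into uniformly Cauchy.
  wlog hq : ∃ q, ∀ n, u n q = 0 generalizing u
  · obtain ⟨q, hqK⟩ := hK.2.1
    have hmem : ∀ n, u n - (fun _ => u n ⟨q, hqK⟩) ∈ T.limitDomain α r₀ lam ρ K := fun n =>
      (hR.contraction hα₀ hα₁ hK (hu n) fun x y => by simp).1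
    have hsub : ∀ m n, u m - u n ∈ T.limitDomain α r₀ lam ρ K := fun m n =>
      (mem_limitSpace hR).1 (Submodule.sub_mem _ ((mem_limitSpace hR).2 (hu m))
        ((mem_limitSpace hR).2 (hu n)))
    obtain ⟨v, hv, hlim⟩ := this hmem (fun ε hε => by
      obtain ⟨n₀, h⟩ := hc ε hε
      refine ⟨n₀, fun m hm n hn => lt_of_le_of_lt ?_ (h m hm n hn)⟩
      exact (hR.contraction hα₀ hα₁ hK (hsub m n) fun x y => le_of_eq (by
        simp only [Pi.sub_apply]; ring)).2) ⟨⟨q, hqK⟩, fun n => by simp⟩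
    refine ⟨v, hv, squeeze_zero (fun n => ?_) (fun n => ?_) hlim⟩
    · exact hR.limitEnergy_nonneg ((mem_limitSpace hR).1 (Submodule.sub_mem _
        ((mem_limitSpace hR).2 (hu n)) ((mem_limitSpace hR).2 hv)))
    · have hmem' : u n - (fun _ => u n ⟨q, hqK⟩) - v ∈ T.limitDomain α r₀ lam ρ K :=
        (mem_limitSpace hR).1 (Submodule.sub_mem _ ((mem_limitSpace hR).2 (hmem n))
          ((mem_limitSpace hR).2 hv))
      exact (hR.contraction hα₀ hα₁ hK hmem' fun x y => le_of_eq (by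
        simp only [Pi.sub_apply]; ring)).2
  obtain ⟨q, hq⟩ := hq
  have hsub : ∀ m n, u m - u n ∈ T.limitDomain α r₀ lam ρ K := fun m n =>
    (mem_limitSpace hR).1 (Submodule.sub_mem _ ((mem_limitSpace hR).2 (hu m))
      ((mem_limitSpace hR).2 (hu n)))
  obtain ⟨M, hM, hosc⟩ := hR.exists_sq_sub_le_energy hα₀ hα₁ hK
  have hunif : UniformCauchySeqOn u atTop Set.univ := by
    rw [Metric.uniformCauchySeqOn_iff]
    intro ε hε
    -- `M + 1` avoids division by zero.
    obtain ⟨n₀, h⟩ := hc (ε ^ 2 / (M + 1)) (by positivity)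
    refine ⟨n₀, fun m hm n hn x _ => ?_⟩
    have h1 := hosc _ (hsub m n) x q
    have h2 := h m hm n hn
    simp only [Pi.sub_apply, hq, sub_zero] at h1
    rw [lt_div_iff₀ (by positivity)] at h2
    have h3 := hR.limitEnergy_nonneg (hsub m n)
    rw [Real.dist_eq]
    exact abs_lt_of_sq_lt_sq (by nlinarith) hε.le
  have hpt : ∀ x, ∃ a, Tendsto (fun n => u n x) atTop (𝓝 a) := fun x =>
    cauchySeq_tendsto_of_complete (hunif.cauchySeq (Set.mem_univ x))
  choose v hv using hpt
  have hvu : TendstoUniformlyOn u v atTop Set.univ :=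
    hunif.tendstoUniformlyOn_of_tendsto fun x _ => hv x
  have hvc : Continuous v := by
    rw [← continuousOn_univ]
    exact hvu.continuousOn (Frequently.of_forall fun n => (hu n).1.continuousOn)
  have hlimK : ∀ x ∈ K, Tendsto (fun n => extendZero (u n) x) atTop (𝓝 (extendZero v x)) := by
    intro x hx
    simpa only [extendZero_of_mem _ hx] using hv ⟨x, hx⟩
  have hH1 : ∀ w l, MemH1 (extendZero v ∘ wordMap (S.stretch α) w ∘ T.linePath α l) ∧
      Tendsto (fun n => dirichletEnergy (extendZero (u n) ∘ wordMap (S.stretch α) w ∘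
        T.linePath α l - extendZero v ∘ wordMap (S.stretch α) w ∘ T.linePath α l)) atTop (𝓝 0) := by
    intro w l
    refine memH1_of_cauchy (fun n => (hu n).2.1 w l)
      (fun t ht => hlimK _ (hK.wordMap_mem w (hK.linePath_mem l ht))) fun ε hε => ?_
    set c := ρ w.length l * ∏ j ∈ Finset.range w.length, lam j with hcdef
    have hcpos : 0 < c := mul_pos ((hR.harmonic _).rho_pos l) (hR.prod_pos _)
    obtain ⟨n₀, h⟩ := hc (ε / c) (by positivity)
    refine ⟨n₀, fun m hm n hn => ?_⟩
    have h1 := hR.dirichletEnergy_line_le w l (extendZero (u m - u n))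
    rw [← mul_assoc, extendZero_sub] at h1
    refine lt_of_le_of_lt h1 ?_
    rw [← extendZero_sub, ← lt_div_iff₀' hcpos]
    exact (hR.levelEnergy_le (hsub m n) _).trans_lt (h m hm n hn)
  have hvV : v ∈ linewiseSpace T α K := ⟨hvc, fun w l => (hH1 w l).1⟩
  have huV : ∀ n, u n ∈ linewiseSpace T α K := fun n => ⟨(hu n).1, (hu n).2.1⟩
  have hto0 : ∀ m, Tendsto (fun n => T.levelEnergy α r₀ lam ρ m (extendZero (u n - v))) atTop
      (𝓝 0) := by
    refine tendsto_levelEnergy_of_tendsto hα₀ hα₁ hK (fun x hx => ?_) fun w l => ?_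
    · simpa [extendZero_sub] using (hlimK x hx).sub_const (extendZero v x)
    · simp only [extendZero_sub]
      exact (hH1 w l).2
  -- Compare `u n` with `v` through `u k`: the first difference is small uniformly in the level `m`,
  -- the second vanishes as `k → ∞` for fixed `m`. The bound is thus uniform in `m`.
  have hbound : ∀ ε > 0, ∃ n₀, ∀ n ≥ n₀, ∀ m,
      T.levelEnergy α r₀ lam ρ m (extendZero (u n - v)) ≤ ε := by
    intro ε hε
    obtain ⟨n₀, h⟩ := hc (ε / 2) (by positivity)
    refine ⟨n₀, fun n hn m => ?_⟩
    have hlim := ((hto0 m).const_mul 2).const_add ε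
    rw [mul_zero, add_zero] at hlim
    refine ge_of_tendsto hlim (eventually_atTop.2 ⟨n₀, fun k hk => ?_⟩)
    have hpar := QuadraticMap.parallelogram (levelForm T α r₀ lam ρ K m)
      (⟨u n, huV n⟩ - ⟨u k, huV k⟩) (⟨u k, huV k⟩ - ⟨v, hvV⟩)
    rw [sub_add_sub_cancel] at hpar
    simp only [levelForm_apply, Submodule.coe_sub] at hpar
    have hnn := hR.levelEnergy_nonneg m (extendZero (u n - u k - (u k - v)))
    have hnk := (hR.levelEnergy_le (hsub n k) m).trans (h n hn k hk).le
    linarith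
  have hdom : ∀ n, (∃ C, ∀ m, T.levelEnergy α r₀ lam ρ m (extendZero (u n - v)) ≤ C) →
      u n - v ∈ T.limitDomain α r₀ lam ρ K := fun n hn =>
    hR.mem_limitDomain_iff.2 ⟨Submodule.sub_mem _ (huV n) hvV, hn⟩
  obtain ⟨n₁, hn₁⟩ := hbound 1 one_pos
  have hvdom : v ∈ T.limitDomain α r₀ lam ρ K := by
    have h1 := hdom n₁ ⟨1, hn₁ n₁ le_rfl⟩
    have := Submodule.sub_mem _ ((mem_limitSpace hR).2 (hu n₁)) ((mem_limitSpace hR).2 h1)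
    rw [sub_sub_cancel] at this
    exact (mem_limitSpace hR).1 this
  have hsubv : ∀ n, u n - v ∈ T.limitDomain α r₀ lam ρ K := fun n =>
    (mem_limitSpace hR).1 (Submodule.sub_mem _ ((mem_limitSpace hR).2 (hu n))
      ((mem_limitSpace hR).2 hvdom))
  refine ⟨v, hvdom, Metric.tendsto_atTop.2 fun ε hε => ?_⟩
  obtain ⟨n₀, h⟩ := hbound (ε / 2) (by positivity)
  refine ⟨n₀, fun n hn => ?_⟩
  rw [Real.dist_eq, sub_zero, abs_of_nonneg (hR.limitEnergy_nonneg (hsubv n))]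
  exact (le_of_tendsto' (tendsto_levelEnergy (hsubv n)) (h n hn)).trans_lt (by linarith)

/-! ### The resistance form -/

theorem IsRegularSequence.isResistanceForm (hR : T.IsRegularSequence α r₀ lam ρ)
    (hα₀ : 0 ≤ α) (hα₁ : α < 1) (hK : T.IsStretchedFractal α K)
    {A : Set (EuclideanSpace ℝ (Fin d))} (hA : S.IsFractalPart α A)
    (hA_disc : IsTotallyDisconnected A) :
    IsResistanceForm (T.limitDomain α r₀ lam ρ K) (T.limitEnergy α r₀ lam ρ K) where
  quadratic := by
    obtain ⟨Q, hQ⟩ := hR.exists_limitForm (K := K)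
    refine ⟨limitSpace hR K, QuadraticMap.associated Q, Set.ext fun u => mem_limitSpace hR,
      fun u v => ?_, fun u => ?_⟩
    · exact QuadraticMap.associated_isSymm ℝ Q u v
    · rw [← hQ u, QuadraticMap.associated_eq_self_apply]
  const_mem a := (hR.const_mem hα₀ hα₁ hK a).1
  nonneg u hu := hR.limitEnergy_nonneg hu
  eq_zero_iff u hu := by
    constructor
    · intro h0
      obtain ⟨M, hM, hosc⟩ := hR.exists_sq_sub_le_energy hα₀ hα₁ hK
      obtain ⟨q, hq⟩ := hK.2.1
      refine ⟨u ⟨q, hq⟩, funext fun x => ?_⟩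
      have := hosc u hu x ⟨q, hq⟩
      rw [h0, mul_zero] at this
      exact sub_eq_zero.1 (pow_eq_zero_iff two_ne_zero |>.1 (le_antisymm this (sq_nonneg _)))
    · rintro ⟨a, rfl⟩
      exact (hR.const_mem hα₀ hα₁ hK a).2
  complete u hu hc := hR.complete hα₀ hα₁ hK hu hc
  separates x y hxy := hR.separates hα₀ hα₁ hK hA hA_disc hxy
  finite_resistance p q := by
    obtain ⟨M, hM, hosc⟩ := hR.exists_sq_sub_le_energy hα₀ hα₁ hK
    refine ⟨M, ?_⟩
    rintro _ ⟨u, hu, hE, rfl⟩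
    rw [sq_abs, div_le_iff₀ hE]
    exact hosc u hu p q
  markov u hu := hR.contraction hα₀ hα₁ hK hu fun x y => by
    refine sq_le_sq.2 ((abs_max_sub_max_le_max _ _ _ _).trans ?_)
    refine max_le (by simp) ((abs_min_sub_min_le_max _ _ _ _).trans (max_le (by simp) le_rfl))

/-- If `u x` and `u y` lie on one side of `c`, only one part changes; otherwise the increment of `u`
is split into two of equal sign, whose squares sum to at most its square. -/
theorem IsRegularSequence.positive_negative_part (hR : T.IsRegularSequence α r₀ lam ρ)
    (hα₀ : 0 ≤ α) (hα₁ : α < 1) (hK : T.IsStretchedFractal α K) {u : K → ℝ}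
    (hu : u ∈ T.limitDomain α r₀ lam ρ K) (c : ℝ) :
    (fun x => max (u x - c) 0) ∈ T.limitDomain α r₀ lam ρ K ∧
      (fun x => max (c - u x) 0) ∈ T.limitDomain α r₀ lam ρ K ∧
      T.limitEnergy α r₀ lam ρ K (fun x => max (u x - c) 0) +
        T.limitEnergy α r₀ lam ρ K (fun x => max (c - u x) 0) ≤ T.limitEnergy α r₀ lam ρ K u := by
  refine hR.mem_of_sq_add_sq_le hα₀ hα₁ hK hu fun x y => ?_
  rcases le_total (u x) c with hx | hx <;> rcases le_total (u y) c with hy | hy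
  · rw [max_eq_right (sub_nonpos.2 hx), max_eq_right (sub_nonpos.2 hy),
      max_eq_left (sub_nonneg.2 hx), max_eq_left (sub_nonneg.2 hy)]
    exact le_of_eq (by ring)
  · rw [max_eq_right (sub_nonpos.2 hx), max_eq_left (sub_nonneg.2 hy),
      max_eq_left (sub_nonneg.2 hx), max_eq_right (sub_nonpos.2 hy)]
    nlinarith [mul_nonneg (sub_nonneg.2 hx) (sub_nonneg.2 hy)]
  · rw [max_eq_left (sub_nonneg.2 hx), max_eq_right (sub_nonpos.2 hy),
      max_eq_right (sub_nonpos.2 hx), max_eq_left (sub_nonneg.2 hy)]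
    nlinarith [mul_nonneg (sub_nonneg.2 hx) (sub_nonneg.2 hy)]
  · rw [max_eq_left (sub_nonneg.2 hx), max_eq_left (sub_nonneg.2 hy),
      max_eq_right (sub_nonpos.2 hx), max_eq_right (sub_nonpos.2 hy)]
    exact le_of_eq (by ring)

/-- `K` is a finite union of closed pieces that are small in resistance: cells of a high level `n`,
and short subsegments of the lines of lower levels. Near `x` only pieces containing `x` occur. -/
theorem IsRegularSequence.eventually_resistance_lt (hR : T.IsRegularSequence α r₀ lam ρ)
    (hα₀ : 0 ≤ α) (hα₁ : α < 1) (hK : T.IsStretchedFractal α K) (x : K) {ε : ℝ} (hε : 0 < ε) :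
    ∀ᶠ y in 𝓝 x, resistance (T.limitDomain α r₀ lam ρ K) (T.limitEnergy α r₀ lam ρ K) y x < ε := by
  obtain ⟨M, hM, hosc⟩ := hR.exists_sq_sub_le hα₀ hα₁ hK
  obtain ⟨L, hL₁, hL⟩ := hR.lam_le
  obtain ⟨R, hRho⟩ := hR.rho_le
  have hL₀ : 0 ≤ L := (hR.harmonic 0).lam_pos.le.trans (hL 0)
  obtain ⟨n, hn⟩ : ∃ n, M * ∏ j ∈ Finset.range n, lam j ≤ ε / 2 := by
    have : Tendsto (fun n : ℕ => M * L ^ n) atTop (𝓝 0) := by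
      simpa using (tendsto_pow_atTop_nhds_zero_of_lt_one hL₀ hL₁).const_mul M
    obtain ⟨n, hn⟩ := (this.eventually_lt_const (half_pos hε)).exists
    refine ⟨n, (mul_le_mul_of_nonneg_left ?_ hM).trans hn.le⟩
    simpa using hR.prod_add_le hL 0 n
  -- By the Hölder bound, a segment of parameter length `1/m` has resistance at most `R/m < ε/2`.
  obtain ⟨m, hm⟩ := exists_nat_gt (R / (ε / 2))
  have hclosed : ∀ B : Set (EuclideanSpace ℝ (Fin d)), IsClosed B →
      ∀ᶠ y : K in 𝓝 x, (y : EuclideanSpace ℝ (Fin d)) ∈ B → (x : EuclideanSpace ℝ (Fin d)) ∈ B := by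
    intro B hB
    by_cases hx : (x : EuclideanSpace ℝ (Fin d)) ∈ B
    · exact Eventually.of_forall fun _ _ => hx
    · filter_upwards [(hB.isOpen_compl.preimage continuous_subtype_val).mem_nhds hx] with y hy hyB
      exact absurd hyB hy
  have hcells : ∀ᶠ y : K in 𝓝 x, ∀ w ∈ {w : List (Fin N) | w.length = n},
      (y : EuclideanSpace ℝ (Fin d)) ∈ wordMap (S.stretch α) w '' K →
        (x : EuclideanSpace ℝ (Fin d)) ∈ wordMap (S.stretch α) w '' K :=
    (eventually_all_finite (List.finite_length_eq (Fin N) n)).2 fun w _ =>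
      hclosed _ (hK.1.image (S.continuous_wordMap_stretch hα₀ w)).isClosed
  have hlines : ∀ᶠ y : K in 𝓝 x, ∀ w ∈ {w : List (Fin N) | w.length < n},
      ∀ l : S.LineIndex, ∀ j ∈ Set.Iic m,
      (y : EuclideanSpace ℝ (Fin d)) ∈ (wordMap (S.stretch α) w ∘ T.linePath α l) ''
          (Set.Icc 0 1 ∩ Set.Icc ((j : ℝ) / m) ((j + 1 : ℝ) / m)) →
        (x : EuclideanSpace ℝ (Fin d)) ∈ (wordMap (S.stretch α) w ∘ T.linePath α l) ''
          (Set.Icc 0 1 ∩ Set.Icc ((j : ℝ) / m) ((j + 1 : ℝ) / m)) :=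
    (eventually_all_finite (List.finite_length_lt (Fin N) n)).2 fun w _ => eventually_all.2 fun l =>
      (eventually_all_finite (Set.finite_Iic m)).2 fun j _ =>
        hclosed _ ((isCompact_Icc.inter isCompact_Icc).image
          ((S.continuous_wordMap_stretch hα₀ w).comp (T.continuous_linePath α l))).isClosed
  filter_upwards [hcells, hlines] with y hyc hyl
  refine lt_of_le_of_lt (resistance_le (half_pos hε).le fun u hu => ?_) (half_lt_self hε)
  have hE := hR.limitEnergy_nonneg hu
  rcases hK.mem_cell_or_line n y.2 with ⟨w, hw, hy⟩ | ⟨w, hw, l, t, ht, hty⟩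
  · refine (hosc u hu w y x hy (hyc w hw hy)).trans (mul_le_mul_of_nonneg_right ?_ hE)
    rw [hw]
    exact hn
  · have hRpos : 0 < R := ((hR.harmonic 0).rho_pos l).trans_le (hRho 0 l)
    have hm0 : (0 : ℝ) < m := (div_pos hRpos (half_pos hε)).trans hm
    -- The value `j = m` occurs for `t = 1`; hence the range `Set.Iic m` and the intersection with
    -- the unit interval.
    set j := ⌊t * m⌋₊ with hj
    have htm : 0 ≤ t * m := mul_nonneg ht.1 hm0.le
    have hj₁ : (j : ℝ) ≤ t * m := Nat.floor_le htm
    have hj₂ : t * m < j + 1 := Nat.lt_floor_add_one _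
    have hjm : j ≤ m := by
      have : (j : ℝ) ≤ m := hj₁.trans (mul_le_of_le_one_left hm0.le ht.2)
      exact_mod_cast this
    obtain ⟨s, ⟨hs, hs'⟩, hsx⟩ := hyl w hw l j hjm
      ⟨t, ⟨ht, (div_le_iff₀ hm0).2 hj₁, (le_div_iff₀ hm0).2 hj₂.le⟩, hty⟩
    have hts : |t - s| ≤ 1 / m := by
      have h1 := (div_le_iff₀ hm0).1 hs'.1
      have h2 := (le_div_iff₀ hm0).1 hs'.2
      rw [le_div_iff₀ hm0]
      rcases abs_cases (t - s) with h | h <;> rw [h.1] <;> nlinarith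
    have h1 := (hu.2.1 w l).sq_sub_le hs ht
    simp only [Function.comp_apply] at h1 hsx
    rw [hty, hsx, extendZero_coe, extendZero_coe] at h1
    have h2 := hR.dirichletEnergy_line_le w l (extendZero u)
    have hprod : ∏ j ∈ Finset.range w.length, lam j ≤ 1 :=
      Finset.prod_le_one (fun k _ => (hR.harmonic k).lam_pos.le)
        fun k _ => (hR.harmonic k).lam_lt_one.le
    have h3 : dirichletEnergy (extendZero u ∘ wordMap (S.stretch α) w ∘ T.linePath α l) ≤
        R * T.limitEnergy α r₀ lam ρ K u := by
      refine h2.trans (mul_le_mul (hRho _ _) ?_ (mul_nonneg (hR.prod_pos _).le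
        (hR.levelEnergy_nonneg _ _)) hRpos.le)
      exact (mul_le_of_le_one_left (hR.levelEnergy_nonneg _ _) hprod).trans (hR.levelEnergy_le hu _)
    refine h1.trans ((mul_le_mul hts h3 (dirichletEnergy_nonneg _) (by positivity)).trans ?_)
    rw [← mul_assoc]
    refine mul_le_mul_of_nonneg_right ?_ hE
    rw [one_div_mul_eq_div, div_le_iff₀ hm0]
    rw [div_lt_iff₀ (half_pos hε)] at hm
    linarith

end StretchableSet.Addressing

/-! ### The resistance form and its topology -/

theorem theorem4p7 {d N : ℕ} (S : StretchableSet d N) (T : S.Addressing)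
    (α : ℝ) (hα₀ : 0 < α) (hα₁ : α < 1)
    (A : Set (EuclideanSpace ℝ (Fin d))) (hA : S.IsFractalPart α A)
    (hA_disc : IsTotallyDisconnected A)
    (K : Set (EuclideanSpace ℝ (Fin d))) (hK : T.IsStretchedFractal α K)
    (r₀ : S.postCritical → S.postCritical → ENNReal) (lam : ℕ → ℝ) (ρ : ℕ → S.LineIndex → ℝ)
    (hR : T.IsRegularSequence α r₀ lam ρ) :
    IsResistanceForm (T.limitDomain α r₀ lam ρ K) (T.limitEnergy α r₀ lam ρ K) ∧
    ∃ m : MetricSpace K,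
      (∀ x y, m.dist x y =
        resistance (T.limitDomain α r₀ lam ρ K) (T.limitEnergy α r₀ lam ρ K) x y) ∧
      m.toPseudoMetricSpace.toUniformSpace.toTopologicalSpace = instTopologicalSpaceSubtype := by
  have hform := hR.isResistanceForm hα₀.le hα₁ hK hA hA_disc
  obtain ⟨m, hm⟩ := hform.exists_metricSpace fun u hu c =>
    hR.positive_negative_part hα₀.le hα₁ hK hu c
  have : CompactSpace K := isCompact_iff_compactSpace.1 hK.1
  refine ⟨hform, m, hm, m.toTopologicalSpace_eq_of_compact fun x ε hε => ?_⟩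
  simp only [hm]
  exact hR.eventually_resistance_lt hα₀.le hα₁ hK x hε
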